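/- Let $ABC$ be a nondegenerate triangle in the Euclidean plane with $a=BC$, $b=CA$, $c=AB$, angles $\alpha,\beta,\gamma$ at $A,B,C$, area $S$, circumscribed circle $k$ and circumradius $R$. Let $\lambda,\mu,\nu$ be positive numbers and $$G(Y)=-\lambda\, AY+\mu\, BY+\nu\, CY$$ for points $Y$ of the plane. "Minimizer" means a point where the global minimum of $G$ is attained. (0) If $\lambda\ge\mu+\nu$, then $G$ has no minimizer. If $\mu\ge\nu+\lambda$, then $B$ is the unique minimizer. If $\nu\ge\lambda+\mu$, then $C$ is the unique minimizer. Suppose now that $\lambda<\mu+\nu$, $\mu<\nu+\lambda$, $\nu<\lambda+\mu$. Then there is a triangle with sides $\lambda,\mu,\nu$; let $\alpha_1,\beta_1,\gamma_1$ be its angles opposite to these sides, respectively. Put $$g(Y)=-\sin\alpha_1\, AY+\sin\beta_1\, BY+\sin\gamma_1\, CY .$$ Then $G=\frac{\lambda}{\sin\alpha_1}\,g$ with $\frac{\lambda}{\sin\alpha_1}>0$, so $G$ and $g$ have the same minimizers, and the following holds. (1) If $\beta_1=\beta$ and $\gamma_1=\gamma$, then the minimizers are exactly the points of the closed arc $BC$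 of $k$ not containing $A$, and $g_{\min}=0$. (2) If $\beta_1<\beta$ and $\gamma_1<\gamma$, then there is a unique point $P$ exterior to $k$ whose pedal triangle $A_1B_1C_1$ ($A_1,B_1,C_1$ being the feet of the perpendiculars from $P$ to the lines $BC,CA,AB$) is nondegenerate with angles $\alpha_1,\beta_1,\gamma_1$ at $A_1,B_1,C_1$. There is a unique point $Q$ which is isogonally conjugate to $P$ of type II relative to $A$, this $Q$ is the unique minimizer, and $$g_{\min}=g(Q)=-\frac{abc}{4RR_1}=-\frac{S}{R_1},$$ where $R_1$ is the circumradius of the triangle $A_1B_1C_1$. (3) In all other cases: - if $\dfrac{\sin\beta_1-\sin\gamma_1}{\sin\alpha_1}>\dfrac{\sin\beta-\sin\gamma}{\sin\alpha}$, then $B$ is the unique minimizer; - if $\dfrac{\sin\beta_1-\sin\gamma_1}{\sin\alpha_1}=\dfrac{\sin\beta-\sin\gamma}{\sin\alpha}$, then the minimizers are exactly $B$ and $C$; - if $\dfrac{\sin\beta_1-\sin\gamma_1}{\sin\alpha_1}<\dfrac{\sin\beta-\sin\gamma}{\sin\alpha}$, then $C$ is the unique minimizer. Here $X$ and $Y$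 are isogonally conjugate with respect to $ABC$ if for each vertex $V\notin\{X,Y\}$ the lines $VX$ and $VY$ are symmetric in the bisector of the angle of the triangle at $V$. Let $\sigma_{12}$ be the set of points that lie inside the angle $BAC$, on the opposite side of $BC$ from $A$, and outside $k$. Isogonally conjugate points $X,Y$ are of type II relative to $A$ if both lie in $\sigma_{12}$ or both lie on the boundary of $\sigma_{12}$. -/

import Mathlib

open EuclideanGeometry Affine

noncomputable section

/-- The Euclidean plane. -/
abbrev Plane : Type := EuclideanSpace ℝ (Fin 2)

/-- The triangle with non-collinear vertices `A`, `B`, `C`. -/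
def mkTriangle (A B C : Plane) (h : AffineIndependent ℝ ![A, B, C]) : Affine.Triangle ℝ Plane :=
  ⟨![A, B, C], h⟩

/-- The circumcenter of the triangle `A B C`. -/
def triCircumcenter (A B C : Plane) (h : AffineIndependent ℝ ![A, B, C]) : Plane :=
  (mkTriangle A B C h).circumcenter

/-- The circumradius of the triangle `A B C`. -/
def triCircumradius (A B C : Plane) (h : AffineIndependent ℝ ![A, B, C]) : ℝ :=
  (mkTriangle A B C h).circumradius

/-- The foot of the perpendicular from `M` to the line `U V`. -/
def foot (U V M : Plane) : Plane :=
  (orthogonalProjection line[ℝ, U, V] M : Plane)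

/-- The area of the triangle `A B C`: half the base `B C` times the height from `A`. -/
def triArea (A B C : Plane) : ℝ :=
  dist B C * dist A (foot B C A) / 2

/-- `X Y Z` is a nondegenerate triangle with angles `α`, `β`, `γ` at `X`, `Y`, `Z`. -/
def IsTriangleWithAngles (X Y Z : Plane) (α β γ : ℝ) : Prop :=
  AffineIndependent ℝ ![X, Y, Z] ∧ ∠ Y X Z = α ∧ ∠ X Y Z = β ∧ ∠ X Z Y = γ

/-- `α`, `β`, `γ` are the angles of a triangle, opposite to its sides of lengths `l`, `m`, `n`
respectively. -/
def AreAnglesOfSides (l m n α β γ : ℝ) : Prop :=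
  ∃ X Y Z : Plane, dist Y Z = l ∧ dist Z X = m ∧ dist X Y = n ∧ IsTriangleWithAngles X Y Z α β γ

/-- The angles of the pedal triangle of `M` with respect to `A B C` are `α₁`, `β₁`, `γ₁`
at the feet of the perpendiculars to `B C`, `C A`, `A B` respectively. -/
def HasPedalAngles (A B C M : Plane) (α₁ β₁ γ₁ : ℝ) : Prop :=
  IsTriangleWithAngles (foot B C M) (foot C A M) (foot A B M) α₁ β₁ γ₁

/-- The internal bisector of the angle `U V W`, as a line. -/
def bisectorLine (U V W : Plane) : AffineSubspace ℝ Plane :=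
  line[ℝ, V, V + (‖U - V‖⁻¹ • (U - V) + ‖W - V‖⁻¹ • (W - V))]

instance (U V W : Plane) : Nonempty (bisectorLine U V W) := by
  unfold bisectorLine; infer_instance

/-- The lines `V X` and `V Y` are symmetric to each other in the bisector of the angle `U V W`
(no condition if `X = V` or `Y = V`). -/
def AreIsogonalAt (U V W X Y : Plane) : Prop :=
  Collinear ℝ {V, reflection (bisectorLine U V W) X, Y}

/-- `X` and `Y` are isogonally conjugate with respect to the triangle `A B C`. When `X` is the
vertex `A` this says that `Y` lies on the line `B C`, and a point of the circumscribed circle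
which is not a vertex has no conjugate. -/
def AreIsogonallyConjugate (A B C X Y : Plane) : Prop :=
  AreIsogonalAt B A C X Y ∧ AreIsogonalAt C B A X Y ∧ AreIsogonalAt A C B X Y

/-- The points inside the angle `B A C`, beyond the line `B C` as seen from `A`, and outside
the circumscribed circle. -/
def sigma12 (A B C : Plane) (h : AffineIndependent ℝ ![A, B, C]) : Set Plane :=
  {X | line[ℝ, A, B].SSameSide C X ∧ line[ℝ, A, C].SSameSide B X ∧ line[ℝ, B, C].SOppSide A X ∧
    triCircumradius A B C h < dist X (triCircumcenter A B C h)}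

/-- `X` and `Y` are isogonally conjugate of type II relative to `A`. -/
def AreIsogonalTypeII (A B C : Plane) (h : AffineIndependent ℝ ![A, B, C]) (X Y : Plane) : Prop :=
  AreIsogonallyConjugate A B C X Y ∧
    ((X ∈ sigma12 A B C h ∧ Y ∈ sigma12 A B C h) ∨
      (X ∈ frontier (sigma12 A B C h) ∧ Y ∈ frontier (sigma12 A B C h)))

/-- The closed arc `B C` of the circumscribed circle which does not contain `A`. -/
def arcBC (A B C : Plane) (h : AffineIndependent ℝ ![A, B, C]) : Set Plane :=
  {Y | dist Y (triCircumcenter A B C h) = triCircumradius A B C h ∧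
    line[ℝ, B, C].WOppSide A Y}

/-- The objective `-l·AY + m·BY + n·CY`. -/
def mixedFermat (A B C : Plane) (l m n : ℝ) (Y : Plane) : ℝ :=
  -l * dist A Y + m * dist B Y + n * dist C Y

/-- The set of points of the plane at which `f` attains its minimum. -/
def minimizers (f : Plane → ℝ) : Set Plane :=
  {Y | ∀ Z, f Y ≤ f Z}

end

/-!
The argument rests on the apex `D` of the triangle `D B C` that lies on `A`'s side of the line `B C`
and has sides `BC : CD : DB = l : m : n`; its angles at `B` and `C` are `β₁` and `γ₁`.
Ptolemy's inequality for `D`, `B`, `Y`, `C` reads `m·BY + n·CY ≥ l·DY`, with equality exactly on the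
arc `B C` of the circle `B C D` which does not contain `D`. Hence the objective satisfies
`G(Y) ≥ l (DY - AY) ≥ -l·AD` (`mul_dist_sub_le_mixedFermat`).

* If `D = A`, the bound is `0` and it is attained on the arc `B C` (`minimizers_eq_arcBC`).
* The point `D` is inside the triangle exactly when `β₁ < β` and `γ₁ < γ`
  (`angle_lt_angle_iff_pos`). Then `-l·AD` is attained only at the second intersection `Q` of the
  line `A D` with the circle `B C D` (`minimizers_eq_singleton_ray`). The inversion with centre `A`
  and power `AB · AC`, followed by the reflection in the bisector at `A`, exchanges `B` and `C`, and
  sends `D` to a point `P` whose pedal triangle is similar to `D B C`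
  (`hasPedalAngles_sqrtInversion_iff`); `P` is outside the circumscribed circle exactly when `D` is
  on `A`'s side of `B C` (`lt_dist_sqrtInversion_iff`). So existence and uniqueness of `P` are those
  of `D`, and `P` and `Q` are isogonally conjugate because `B`, `C`, `D`, `Q` are concyclic
  (`areIsogonallyConjugate_sqrtInversion`). The stated values of the minimum follow from
  `AP · AD = AB · AC` and the law of sines.
* In the remaining cases a minimizer exists since `l < m + n`. At a minimizer `Y` other than a
  vertex the gradient vanishes, and then the point `D` of the line `Y A` at distance
  `(m·BY + n·CY) / l` from `Y`, towards `A`, has `BC : CD : DB = l : m : n`. If `DY ≥ AY`, then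
  `G(Y) = l·AD` is at least `G(B)` and `G(C)`, with equality in both only for `D = A`; if
  `DY < AY`, then `D` is inside the triangle (`exists_apex_of_mem_minimizers`). Both are
  excluded, so only `B` and `C` remain, and their values are compared directly.

Weights violating a triangle inequality are settled by the triangle inequality for distances.

Points of the plane are treated through the inner product and the cross product `cross`, and points
relative to the triangle through the coordinates `y`, `z` in `A + y (B - A) + z (C - A)`.
-/

/-! ### Cross products, collinearity and sides of lines -/

/-- The cross product (determinant) of two plane vectors. -/
def cross (u v : Plane) : ℝ := u 0 * v 1 - u 1 * v 0

theorem inner_eq_coord (u v : Plane) : inner ℝ u v = u 0 * v 0 + u 1 * v 1 := by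
  simp [PiLp.inner_apply, Fin.sum_univ_two]; ring

theorem norm_sq_eq_coord (u : Plane) : ‖u‖ ^ 2 = u 0 ^ 2 + u 1 ^ 2 := by
  simp [EuclideanSpace.norm_sq_eq, Fin.sum_univ_two]

theorem dist_sq_eq_coord (X Y : Plane) :
    dist X Y ^ 2 = (X 0 - Y 0) ^ 2 + (X 1 - Y 1) ^ 2 := by
  rw [dist_eq_norm, norm_sq_eq_coord]; simp

theorem plane_ext {X Y : Plane} (h0 : X 0 = Y 0) (h1 : X 1 = Y 1) : X = Y := by
  ext i; fin_cases i <;> simpa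

/-- Lagrange's identity in the plane. -/
theorem inner_sq_add_cross_sq (u v : Plane) :
    inner ℝ u v ^ 2 + cross u v ^ 2 = ‖u‖ ^ 2 * ‖v‖ ^ 2 := by
  rw [inner_eq_coord, norm_sq_eq_coord, norm_sq_eq_coord, cross]; ring

/-- Two vectors with nonzero cross product form a basis, with coordinates given by Cramer's
rule. -/
theorem eq_smul_add_smul_of_cross_ne_zero {u v : Plane} (h : cross u v ≠ 0) (w : Plane) :
    w = (cross w v / cross u v) • u + (cross u w / cross u v) • v := by
  apply plane_ext <;> simp <;> field_simp <;> simp only [cross] <;> ring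

theorem exists_smul_of_cross_eq_zero {u v : Plane} (hu : u ≠ 0) (h : cross u v = 0) :
    ∃ r : ℝ, v = r • u := by
  have hu' : ‖u‖ ^ 2 ≠ 0 := by simpa using hu
  refine ⟨inner ℝ u v / ‖u‖ ^ 2, ?_⟩
  rw [norm_sq_eq_coord] at hu'
  rw [inner_eq_coord, norm_sq_eq_coord]
  unfold cross at h
  apply plane_ext <;> simp <;> field_simp
  · linear_combination (-(u 1)) * h
  · linear_combination (u 0) * h

theorem mem_line_iff_cross {U V X : Plane} (h : U ≠ V) :
    X ∈ line[ℝ, U, V] ↔ cross (V - U) (X - U) = 0 := by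
  rw [mem_affineSpan_pair_iff_exists_lineMap_eq]
  constructor
  · rintro ⟨r, rfl⟩
    simp [AffineMap.lineMap_apply, cross]; ring
  · intro hc
    obtain ⟨r, hr⟩ := exists_smul_of_cross_eq_zero (sub_ne_zero.2 h.symm) hc
    refine ⟨r, ?_⟩
    rw [AffineMap.lineMap_apply, vsub_eq_sub, ← hr]; simp

theorem collinear_iff_cross (X Y Z : Plane) :
    Collinear ℝ {X, Y, Z} ↔ cross (Y - X) (Z - X) = 0 := by
  by_cases h : X = Y
  · subst h
    simp [collinear_pair, cross]
  · rw [← mem_line_iff_cross h]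
    constructor
    · intro hc
      exact hc.mem_affineSpan_of_mem_of_ne (by simp) (by simp) (by simp) h
    · intro hm
      have := (collinear_insert_iff_of_mem_affineSpan hm).2 (collinear_pair ℝ X Y)
      convert this using 1
      ext; simp; tauto

theorem affineIndependent_iff_cross (X Y Z : Plane) :
    AffineIndependent ℝ ![X, Y, Z] ↔ cross (Y - X) (Z - X) ≠ 0 := by
  rw [affineIndependent_iff_not_collinear_set, collinear_iff_cross]

theorem wOppSide_line_iff {U V X Y : Plane} (h : U ≠ V) :
    line[ℝ, U, V].WOppSide X Y ↔ cross (V - U) (X - U) * cross (V - U) (Y - U) ≤ 0 := by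
  rw [AffineSubspace.wOppSide_iff_exists_wbtw]
  constructor
  · rintro ⟨p, hp, t, ⟨ht0, ht1⟩, rfl⟩
    rw [mem_line_iff_cross h] at hp
    have hp' : (1 - t) * cross (V - U) (X - U) + t * cross (V - U) (Y - U) = 0 := by
      rw [← hp]; simp [AffineMap.lineMap_apply, cross]; ring
    generalize cross (V - U) (X - U) = a at *
    generalize cross (V - U) (Y - U) = b at *
    by_contra hab
    push Not at hab
    have h1 : (1 - t) * a ^ 2 + t * (a * b) = 0 := by linear_combination a * hp'
    have ha : 0 < a ^ 2 := by
      have : a ≠ 0 := by rintro rfl; simp at hab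
      positivity
    rcases eq_or_lt_of_le ht0 with h0 | h0
    · subst h0; nlinarith
    · nlinarith [mul_pos h0 hab, mul_nonneg (sub_nonneg.2 ht1) ha.le]
  · intro hc
    by_cases hx : cross (V - U) (X - U) = 0
    · exact ⟨X, (mem_line_iff_cross h).2 hx, wbtw_self_left _ _ _⟩
    set a := cross (V - U) (X - U) with ha
    set b := cross (V - U) (Y - U) with hb
    have hab : 0 < a * (a - b) := by
      have : 0 < a ^ 2 := by positivity
      nlinarith
    have hne : a - b ≠ 0 := by rintro h0; rw [h0] at hab; simp at hab
    refine ⟨AffineMap.lineMap X Y (a / (a - b)), (mem_line_iff_cross h).2 ?_,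
      a / (a - b), ⟨?_, ?_⟩, rfl⟩
    · have : cross (V - U) (AffineMap.lineMap X Y (a / (a - b)) - U) =
          a + a / (a - b) * (b - a) := by
        simp [AffineMap.lineMap_apply, cross, ha, hb]; ring
      rw [this]; field_simp; ring
    · rw [show a / (a - b) = a * (a - b) / (a - b) ^ 2 by field_simp]
      positivity
    · rw [show a / (a - b) = a * (a - b) / (a - b) ^ 2 by field_simp,
        div_le_one (by positivity)]
      have : 0 ≤ b ^ 2 := by positivity
      nlinarith

theorem sOppSide_line_of_cross {U V X Y : Plane} (h : U ≠ V)
    (hc : cross (V - U) (X - U) * cross (V - U) (Y - U) < 0) : line[ℝ, U, V].SOppSide X Y := by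
  refine ⟨(wOppSide_line_iff h).2 hc.le, ?_, ?_⟩ <;> rw [mem_line_iff_cross h] <;> intro h0 <;>
    rw [h0] at hc <;> simp at hc

theorem sSameSide_line_of_cross {U V X Y : Plane} (h : U ≠ V)
    (hc : 0 < cross (V - U) (X - U) * cross (V - U) (Y - U)) : line[ℝ, U, V].SSameSide X Y := by
  refine ⟨?_, ?_, ?_⟩
  · have hx : cross (V - U) (X - U) ≠ 0 := by intro h0; rw [h0] at hc; simp at hc
    have hY := eq_smul_add_smul_of_cross_ne_zero hx (Y - U)
    refine (AffineSubspace.wSameSide_iff_exists_left (left_mem_affineSpan_pair ℝ U V)).2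
      (Or.inr ⟨AffineMap.lineMap U V (cross (Y - U) (X - U) / cross (V - U) (X - U)),
        AffineMap.lineMap_mem_affineSpan_pair _ _ _, ?_⟩)
    have : Y -ᵥ AffineMap.lineMap U V (cross (Y - U) (X - U) / cross (V - U) (X - U)) =
        (cross (V - U) (Y - U) / cross (V - U) (X - U)) • (X -ᵥ U) := by
      rw [AffineMap.lineMap_apply, vsub_eq_sub, vsub_eq_sub, vsub_eq_sub, vadd_eq_add,
        sub_add_eq_sub_sub_swap]
      nth_rewrite 1 [hY]
      abel
    rw [this]
    apply SameRay.sameRay_nonneg_smul_right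
    rw [show cross (V - U) (Y - U) / cross (V - U) (X - U) =
      cross (V - U) (X - U) * cross (V - U) (Y - U) / cross (V - U) (X - U) ^ 2 by field_simp]
    positivity
  all_goals
    rw [mem_line_iff_cross h]; intro h0; rw [h0] at hc; simp at hc

/-! ### Angles -/

theorem sin_angle_mul_norm_mul_norm_eq_abs_cross (u v : Plane) :
    Real.sin (InnerProductGeometry.angle u v) * (‖u‖ * ‖v‖) = |cross u v| := by
  rw [InnerProductGeometry.sin_angle_mul_norm_mul_norm, ← Real.sqrt_sq_eq_abs]
  congr 1
  have := inner_sq_add_cross_sq u v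
  rw [real_inner_self_eq_norm_sq, real_inner_self_eq_norm_sq]
  linarith

/-- Comparison of angles through cotangents. -/
theorem angle_lt_angle_iff {u v u' v' : Plane} (h : cross u v ≠ 0) (h' : cross u' v' ≠ 0) :
    InnerProductGeometry.angle u v < InnerProductGeometry.angle u' v' ↔
      inner ℝ u' v' * |cross u v| < inner ℝ u v * |cross u' v'| := by
  have ne : ∀ {a b : Plane}, cross a b ≠ 0 → 0 < ‖a‖ * ‖b‖ := by
    intro a b hab
    refine mul_pos (norm_pos_iff.2 ?_) (norm_pos_iff.2 ?_) <;> rintro rfl <;> simp [cross] at hab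
  have e1 := sin_angle_mul_norm_mul_norm_eq_abs_cross u v
  have e2 := sin_angle_mul_norm_mul_norm_eq_abs_cross u' v'
  have e3 := InnerProductGeometry.cos_angle_mul_norm_mul_norm u v
  have e4 := InnerProductGeometry.cos_angle_mul_norm_mul_norm u' v'
  have p1 := ne h
  have p2 := ne h'
  rw [← e1, ← e2, ← e3, ← e4]
  have b1 := InnerProductGeometry.angle_nonneg u v
  have b2 := InnerProductGeometry.angle_le_pi u v
  have b3 := InnerProductGeometry.angle_nonneg u' v'
  have b4 := InnerProductGeometry.angle_le_pi u' v'
  have s1 : 0 < Real.sin (InnerProductGeometry.angle u v) :=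
    pos_of_mul_pos_left (e1 ▸ abs_pos.2 h) p1.le
  have s2 : 0 < Real.sin (InnerProductGeometry.angle u' v') :=
    pos_of_mul_pos_left (e2 ▸ abs_pos.2 h') p2.le
  generalize InnerProductGeometry.angle u v = θ at *
  generalize InnerProductGeometry.angle u' v' = θ' at *
  have key : 0 < Real.sin (θ' - θ) ↔ θ < θ' := by
    have c1 : 0 < θ := lt_of_le_of_ne b1 (by rintro rfl; simp at s1)
    have c2 : 0 < θ' := lt_of_le_of_ne b3 (by rintro rfl; simp at s2)
    constructor
    · intro hs
      by_contra hle
      have := Real.sin_nonpos_of_nonpos_of_neg_pi_le (x := θ' - θ) (by linarith) (by linarith)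
      linarith
    · intro hlt
      exact Real.sin_pos_of_pos_of_lt_pi (by linarith) (by linarith)
  rw [← key, Real.sin_sub]
  have hp := mul_pos p1 p2
  constructor
  · intro hs; nlinarith [mul_pos hs hp]
  · intro hs
    refine pos_of_mul_pos_left (b := ‖u‖ * ‖v‖ * (‖u'‖ * ‖v'‖)) ?_ hp.le
    linarith

/-- With `f`, `e` spanning and `x > 0`, the vector `x f + z e` makes a smaller angle with `e`
than `f` does exactly when `z` is positive. -/
theorem angle_smul_add_smul_lt_iff {f e : Plane} (h : cross f e ≠ 0) {x z : ℝ} (hx : 0 < x) :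
    InnerProductGeometry.angle (x • f + z • e) e < InnerProductGeometry.angle f e ↔ 0 < z := by
  have hc : cross (x • f + z • e) e = x * cross f e := by simp [cross]; ring
  have hi : inner ℝ (x • f + z • e) e = x * inner ℝ f e + z * ‖e‖ ^ 2 := by
    rw [inner_add_left, real_inner_smul_left, real_inner_smul_left, real_inner_self_eq_norm_sq]
  rw [angle_lt_angle_iff (by rw [hc]; positivity) h, hc, hi, abs_mul, abs_of_pos hx]
  have he : 0 < ‖e‖ ^ 2 := by
    have : e ≠ 0 := by rintro rfl; simp [cross] at h
    positivity
  have hp : 0 < |cross f e| := abs_pos.2 h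
  have hpe := mul_pos he hp
  constructor
  · intro hlt
    refine pos_of_mul_pos_left (b := ‖e‖ ^ 2 * |cross f e|) ?_ hpe.le
    linarith
  · intro hz
    linarith [mul_pos hz hpe]

/-! ### Ptolemy's inequality and its equality case -/

/-- Ptolemy's inequality with its equality case: equality holds exactly when `Y` lies on the
circle `D B C`, on the arc `B C` which does not contain `D`. The second condition on the right
says that `Y` is on that circle. -/
theorem ptolemy_le_and_eq_iff {D B C : Plane} (hδ : cross (B - D) (C - D) ≠ 0) (Y : Plane) :
    dist B C * dist D Y ≤ dist C D * dist B Y + dist B D * dist C Y ∧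
      (dist C D * dist B Y + dist B D * dist C Y = dist B C * dist D Y ↔
        cross (B - D) (C - D) * cross (B - Y) (C - Y) ≤ 0 ∧
          cross (B - D) (C - D) * inner ℝ (B - Y) (C - Y) =
            inner ℝ (B - D) (C - D) * cross (B - Y) (C - Y)) := by
  set I := inner ℝ (B - D) (C - D) with hI
  set δ := cross (B - D) (C - D) with hδ'
  set I' := inner ℝ (B - Y) (C - Y) with hI'
  set δ' := cross (B - Y) (C - Y) with hδ''
  have hp : 0 ≤ dist C D * dist B Y := by positivity
  have hq : 0 ≤ dist B D * dist C Y := by positivity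
  have hr : 0 ≤ dist B C * dist D Y := by positivity
  have h1 : (dist B C * dist D Y) ^ 2 - (dist C D * dist B Y) ^ 2 - (dist B D * dist C Y) ^ 2 =
      -2 * (I * I' + δ * δ') := by
    rw [mul_pow, mul_pow, mul_pow]
    simp only [dist_sq_eq_coord, hI, hI', hδ', hδ'', inner_eq_coord, cross, PiLp.sub_apply]
    ring
  have h2 : (I * I' + δ * δ') ^ 2 + (δ * I' - I * δ') ^ 2 =
      ((dist C D * dist B Y) * (dist B D * dist C Y)) ^ 2 := by
    rw [mul_pow, mul_pow, mul_pow]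
    simp only [dist_sq_eq_coord, hI, hI', hδ', hδ'', inner_eq_coord, cross, PiLp.sub_apply]
    ring
  generalize dist C D * dist B Y = p at *
  generalize dist B D * dist C Y = q at *
  generalize dist B C * dist D Y = r at *
  have hpq : 0 ≤ p * q := mul_nonneg hp hq
  refine ⟨?_, ?_, ?_⟩
  · have : -(I * I' + δ * δ') ≤ p * q :=
      (neg_le_abs _).trans (abs_le_of_sq_le_sq (by nlinarith [sq_nonneg (δ * I' - I * δ')]) hpq)
    exact le_of_sq_le_sq (by nlinarith) (by positivity)
  · intro he
    have hS : -(I * I' + δ * δ') = p * q := by rw [← he] at h1; linarith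
    have hT : δ * I' - I * δ' = 0 := by
      have : (δ * I' - I * δ') ^ 2 = 0 := by rw [← hS] at h2; linarith
      exact pow_eq_zero_iff two_ne_zero |>.1 this
    refine ⟨?_, by linarith⟩
    have hδ2 : 0 < I ^ 2 + δ ^ 2 := by positivity
    have : (I ^ 2 + δ ^ 2) * (δ * δ') = -(δ ^ 2 * (p * q)) := by
      rw [← hS]; linear_combination (-I * δ) * hT
    by_contra hc
    push Not at hc
    nlinarith [mul_pos hδ2 hc, mul_nonneg (sq_nonneg δ) hpq]
  · rintro ⟨hle, hT⟩
    have hT' : δ * I' - I * δ' = 0 := by linarith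
    have hδ2 : 0 < δ ^ 2 := by positivity
    have hS : 0 ≤ -(I * I' + δ * δ') := by
      have : δ ^ 2 * -(I * I' + δ * δ') = (I ^ 2 + δ ^ 2) * -(δ * δ') := by
        linear_combination (-I * δ) * hT'
      refine (mul_nonneg_iff_of_pos_left hδ2).1 ?_
      rw [this]
      exact mul_nonneg (by positivity) (by linarith)
    have hS' : -(I * I' + δ * δ') = p * q := by
      rw [hT'] at h2
      exact (sq_eq_sq₀ hS hpq).1 (by linarith)
    exact (sq_eq_sq₀ (by positivity) hr).1 (by linarith)

/-! ### Elementary properties of the objective -/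

theorem mixedFermat_swap (A B C : Plane) (l m n : ℝ) (Y : Plane) :
    mixedFermat A B C l m n Y = mixedFermat A C B l n m Y := by
  unfold mixedFermat; ring

/-- The lower bound which governs the problem: if `D` is the vertex of a triangle `D B C` with
sides proportional to `l`, `m`, `n`, then Ptolemy's inequality replaces `m·BY + n·CY` by
`l·DY`. -/
theorem mul_dist_sub_le_mixedFermat {A B C D : Plane} {l m n : ℝ} (hl : 0 < l) (hBC : B ≠ C)
    (hδ : cross (B - D) (C - D) ≠ 0)
    (hB : l * dist B D = n * dist B C) (hC : l * dist C D = m * dist B C) (Y : Plane) :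
    l * (dist D Y - dist A Y) ≤ mixedFermat A B C l m n Y ∧
      (mixedFermat A B C l m n Y = l * (dist D Y - dist A Y) ↔
        cross (B - D) (C - D) * cross (B - Y) (C - Y) ≤ 0 ∧
          cross (B - D) (C - D) * inner ℝ (B - Y) (C - Y) =
            inner ℝ (B - D) (C - D) * cross (B - Y) (C - Y)) := by
  obtain ⟨h1, h2⟩ := ptolemy_le_and_eq_iff hδ Y
  have ha : 0 < dist B C := dist_pos.2 hBC
  have e : l * (dist C D * dist B Y + dist B D * dist C Y) =
      dist B C * (m * dist B Y + n * dist C Y) := by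
    linear_combination dist B Y * hC + dist C Y * hB
  rw [← h2]
  unfold mixedFermat
  constructor
  · have := mul_le_mul_of_nonneg_left h1 hl.le
    rw [e] at this
    have : dist B C * (l * dist D Y) ≤ dist B C * (m * dist B Y + n * dist C Y) := by linarith
    have := le_of_mul_le_mul_left this ha
    linarith
  · constructor
    · intro h
      apply mul_left_cancel₀ hl.ne'
      rw [e]
      linear_combination dist B C * h
    · intro h
      apply mul_left_cancel₀ ha.ne'
      rw [h] at e
      linear_combination -e

/-! ### Weights violating a triangle inequality -/

theorem vertex_ne_of_cross {A B C : Plane} (h : cross (B - A) (C - A) ≠ 0) :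
    A ≠ B ∧ A ≠ C ∧ B ≠ C := by
  refine ⟨?_, ?_, ?_⟩ <;> rintro rfl <;> apply h <;> simp [cross]
  ring

theorem cross_swap_ne_zero {A B C : Plane} (h : cross (B - A) (C - A) ≠ 0) :
    cross (C - A) (B - A) ≠ 0 := by
  intro h0; apply h; unfold cross at *; linarith

theorem cross_eq_zero_of_wbtw {X Y Z : Plane} (h : Wbtw ℝ X Y Z) :
    cross (Y - X) (Z - X) = 0 := by
  rw [← collinear_iff_cross]; exact h.collinear

theorem cross_eq_zero_of_common_line {A Y B C : Plane} (hY : A ≠ Y)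
    (hB : cross (Y - A) (B - A) = 0) (hC : cross (Y - A) (C - A) = 0) :
    cross (B - A) (C - A) = 0 := by
  obtain ⟨r, hr⟩ := exists_smul_of_cross_eq_zero (sub_ne_zero.2 hY.symm) hB
  obtain ⟨s, hs⟩ := exists_smul_of_cross_eq_zero (sub_ne_zero.2 hY.symm) hC
  rw [hr, hs]; simp [cross]; ring

/-- `A` is never a minimizer: `B` is better. -/
theorem left_notMem_minimizers {A B C : Plane} (h : cross (B - A) (C - A) ≠ 0) {l m n : ℝ}
    (hn : 0 < n) (hl : n < m + l) :
    A ∉ minimizers (mixedFermat A B C l m n) := by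
  intro hA
  have h1 := hA B
  obtain ⟨hAB, hAC, hBC⟩ := vertex_ne_of_cross h
  have hc : 0 < dist A B := dist_pos.2 hAB
  have t := dist_triangle B A C
  simp only [mixedFermat, dist_self, dist_comm B A, dist_comm C A, dist_comm C B] at h1 t
  nlinarith [mul_pos (sub_pos.2 hl) hc, mul_le_mul_of_nonneg_left t hn.le]

/-- Moving a point `Y` straight away from `A` to twice the distance lowers the objective, because
`B` and `C` cannot both be on the line `A Y`. -/
theorem minimizers_eq_empty {A B C : Plane} (h : cross (B - A) (C - A) ≠ 0) {l m n : ℝ}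
    (hm : 0 < m) (hn : 0 < n) (hl : m + n ≤ l) :
    minimizers (mixedFermat A B C l m n) = ∅ := by
  rw [Set.eq_empty_iff_forall_notMem]
  intro Y hY
  by_cases hYA : Y = A
  · subst hYA
    exact left_notMem_minimizers h hn (by linarith) hY
  set Z : Plane := Y + (Y - A) with hZ
  have d1 : dist A Z = 2 * dist A Y := by
    rw [dist_comm A Z, dist_comm A Y, dist_eq_norm, dist_eq_norm,
      show Z - A = (2 : ℝ) • (Y - A) by rw [hZ, two_smul]; abel, norm_smul]
    simp
  have d2 : dist Y Z = dist A Y := by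
    rw [dist_comm Y Z, dist_comm A Y, dist_eq_norm, dist_eq_norm, hZ, add_sub_cancel_left]
  have hd : 0 < dist A Y := dist_pos.2 (Ne.symm hYA)
  have tB := dist_triangle B Y Z
  have tC := dist_triangle C Y Z
  have hmin := hY Z
  simp only [mixedFermat] at hmin
  rw [d1] at hmin
  rw [d2] at tB tC
  have eB : dist B Y + dist Y Z = dist B Z := by
    rw [d2]
    by_contra hne
    have : dist B Z < dist B Y + dist A Y := lt_of_le_of_ne tB (Ne.symm hne)
    nlinarith [mul_pos hm (sub_pos.2 this), mul_nonneg hn.le (sub_nonneg.2 tC),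
      mul_nonneg (sub_nonneg.2 hl) hd.le]
  have eC : dist C Y + dist Y Z = dist C Z := by
    rw [d2]
    by_contra hne
    have : dist C Z < dist C Y + dist A Y := lt_of_le_of_ne tC (Ne.symm hne)
    nlinarith [mul_pos hn (sub_pos.2 this), mul_nonneg hm.le (sub_nonneg.2 tB),
      mul_nonneg (sub_nonneg.2 hl) hd.le]
  have cB := cross_eq_zero_of_wbtw (dist_add_dist_eq_iff.1 eB)
  have cC := cross_eq_zero_of_wbtw (dist_add_dist_eq_iff.1 eC)
  refine h (cross_eq_zero_of_common_line (Ne.symm hYA) ?_ ?_)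
  · simp [cross, hZ] at cB ⊢; linarith
  · simp [cross, hZ] at cC ⊢; linarith

theorem minimizers_eq_singleton_of_add_le {A B C : Plane} (h : cross (B - A) (C - A) ≠ 0)
    {l m n : ℝ} (hl : 0 < l) (hn : 0 < n) (hm : n + l ≤ m) :
    minimizers (mixedFermat A B C l m n) = {B} := by
  obtain ⟨hAB, hAC, hBC⟩ := vertex_ne_of_cross h
  have tA : ∀ Y, dist A Y ≤ dist A B + dist B Y := fun Y => dist_triangle _ _ _
  have tC : ∀ Y, dist C B ≤ dist C Y + dist Y B := fun Y => dist_triangle _ _ _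
  ext Y
  simp only [Set.mem_singleton_iff]
  constructor
  · intro hY
    have hmin := hY B
    simp only [mixedFermat, dist_self] at hmin
    have eA : dist A B + dist B Y = dist A Y := by
      by_contra hne
      have := lt_of_le_of_ne (tA Y) (Ne.symm hne)
      have := tC Y
      rw [dist_comm Y B] at this
      nlinarith [mul_nonneg (sub_nonneg.2 hm) (dist_nonneg (x := B) (y := Y))]
    have eC : dist C Y + dist Y B = dist C B := by
      by_contra hne
      have := lt_of_le_of_ne (tC Y) (Ne.symm hne)
      rw [dist_comm Y B] at this
      have := tA Y
      nlinarith [mul_nonneg (sub_nonneg.2 hm) (dist_nonneg (x := B) (y := Y))]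
    by_contra hYB
    have cA := cross_eq_zero_of_wbtw (dist_add_dist_eq_iff.1 eA)
    have cC := cross_eq_zero_of_wbtw (dist_add_dist_eq_iff.1 eC)
    have := cross_eq_zero_of_common_line (A := B) (B := A) (C := C) (Ne.symm hYB)
      (by simp [cross] at cA ⊢; linarith) (by simp [cross] at cC ⊢; linarith)
    apply h
    simp [cross] at this ⊢
    linarith
  · rintro rfl Z
    simp only [mixedFermat, dist_self]
    have := tA Z
    have := tC Z
    rw [dist_comm Z Y] at this
    nlinarith [mul_nonneg (sub_nonneg.2 hm) (dist_nonneg (x := Y) (y := Z))]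

/-! ### Existence and criticality of minimizers -/

/-- The objective is coercive when `l < m + n`. -/
theorem nonempty_minimizers {A B C : Plane} {l m n : ℝ} (hm : 0 ≤ m) (hn : 0 ≤ n)
    (hl : l < m + n) : (minimizers (mixedFermat A B C l m n)).Nonempty := by
  have hcont : Continuous (mixedFermat A B C l m n) := by unfold mixedFermat; fun_prop
  have hlim : Filter.Tendsto (fun Y => (m + n - l) * dist A Y - (m * dist A B + n * dist A C))
      (Filter.cocompact Plane) Filter.atTop := by
    apply Filter.tendsto_atTop_add_const_right
    apply Filter.Tendsto.const_mul_atTop (by linarith)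
    exact tendsto_dist_left_cocompact_atTop A
  refine hcont.exists_forall_le (Filter.tendsto_atTop_mono (fun Y => ?_) hlim)
  have tB := dist_triangle A B Y
  have tC := dist_triangle A C Y
  simp only [mixedFermat]
  nlinarith

/-- The directional derivative of the norm. -/
theorem hasDerivAt_norm_add_smul {w : Plane} (hw : w ≠ 0) (v : Plane) :
    HasDerivAt (fun t : ℝ => ‖w + t • v‖) (inner ℝ w v / ‖w‖) 0 := by
  have h1 : HasDerivAt (fun t : ℝ => ‖w‖ ^ 2 + 2 * t * inner ℝ w v + t ^ 2 * ‖v‖ ^ 2)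
      (2 * inner ℝ w v) 0 := by
    have := (((hasDerivAt_id (0 : ℝ)).const_mul 2).mul_const (inner ℝ w v)).const_add (‖w‖ ^ 2)
    have := this.add (((hasDerivAt_id (0 : ℝ)).pow 2).mul_const (‖v‖ ^ 2))
    refine this.congr_deriv ?_
    simp
  have hn : 0 < ‖w‖ := norm_pos_iff.2 hw
  have h2 := h1.sqrt (by simp; exact hw)
  have e : (fun t : ℝ => ‖w + t • v‖) =
      fun t : ℝ => Real.sqrt (‖w‖ ^ 2 + 2 * t * inner ℝ w v + t ^ 2 * ‖v‖ ^ 2) := by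
    funext t
    rw [← Real.sqrt_sq (norm_nonneg (w + t • v)), norm_add_sq_real, real_inner_smul_right,
      norm_smul, mul_pow, Real.norm_eq_abs, sq_abs, mul_assoc]
  rw [e]
  convert! h2 using 1
  simp
  field_simp

/-- At a minimizer which is not a vertex the weighted unit vectors from the vertices balance. -/
theorem balance_of_mem_minimizers {A B C Y : Plane} {l m n : ℝ}
    (hY : Y ∈ minimizers (mixedFermat A B C l m n)) (hA : Y ≠ A) (hB : Y ≠ B) (hC : Y ≠ C) :
    (l / dist A Y) • (Y - A) = (m / dist B Y) • (Y - B) + (n / dist C Y) • (Y - C) := by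
  set g : Plane := (m / dist B Y) • (Y - B) + (n / dist C Y) • (Y - C) -
    (l / dist A Y) • (Y - A) with hg
  have key : inner ℝ g g = 0 := by
    have dA := (hasDerivAt_norm_add_smul (sub_ne_zero.2 hA) g).const_mul (-l)
    have dB := (hasDerivAt_norm_add_smul (sub_ne_zero.2 hB) g).const_mul m
    have dC := (hasDerivAt_norm_add_smul (sub_ne_zero.2 hC) g).const_mul n
    have d := (dA.add dB).add dC
    have hmin : IsLocalMin (fun t : ℝ => -l * ‖Y - A + t • g‖ + m * ‖Y - B + t • g‖ +
        n * ‖Y - C + t • g‖) 0 := by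
      refine Filter.Eventually.of_forall fun t => ?_
      have := hY (Y + t • g)
      simp only [mixedFermat, dist_comm _ Y, dist_comm _ (Y + t • g), dist_eq_norm] at this
      simpa [add_sub_right_comm] using this
    have h0 := hmin.hasDerivAt_eq_zero d
    rw [hg, inner_sub_left, inner_add_left, real_inner_smul_left, real_inner_smul_left,
      real_inner_smul_left, ← hg]
    simp only [dist_comm _ Y, dist_eq_norm] at *
    linear_combination h0
  have := inner_self_eq_zero.1 key
  rw [hg, sub_eq_zero] at this
  exact this.symm

/-- A minimizer `Y` which is not a vertex determines a triangle `D B C` with sides proportional to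
`l`, `m`, `n` whose vertex `D`, found on the line `Y A` at distance `(m·BY + n·CY) / l` from `Y`,
is either `A` or an interior point of the triangle `A B C`. -/
theorem exists_apex_of_mem_minimizers {A B C Y : Plane} {l m n : ℝ}
    (h : cross (B - A) (C - A) ≠ 0) (hl : 0 < l) (hm : 0 < m) (hn : 0 < n) (hlt : l < m + n)
    (hY : Y ∈ minimizers (mixedFermat A B C l m n)) (hA : Y ≠ A) (hB : Y ≠ B) (hC : Y ≠ C) :
    ∃ D : Plane, l * dist B D = n * dist B C ∧ l * dist C D = m * dist B C ∧
      (D = A ∨ ∃ y z : ℝ, 0 < y ∧ 0 < z ∧ y + z < 1 ∧ D = A + (y • (B - A) + z • (C - A))) := by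
  have bal := balance_of_mem_minimizers hY hA hB hC
  have hr : 0 < dist A Y := dist_pos.2 (Ne.symm hA)
  have hp : 0 < dist B Y := dist_pos.2 (Ne.symm hB)
  have hq : 0 < dist C Y := dist_pos.2 (Ne.symm hC)
  have eA := dist_sq_eq_coord A Y
  have eB := dist_sq_eq_coord B Y
  have eC := dist_sq_eq_coord C Y
  have gY : mixedFermat A B C l m n Y = -l * dist A Y + m * dist B Y + n * dist C Y := rfl
  have gB := hY B
  have gC := hY C
  rw [gY] at gB gC
  generalize dist A Y = r at *
  generalize dist B Y = p at *
  generalize dist C Y = q at *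
  have bal0 := congrArg (fun X : Plane => X 0) bal
  have bal1 := congrArg (fun X : Plane => X 1) bal
  simp only [PiLp.add_apply, PiLp.smul_apply, PiLp.sub_apply, smul_eq_mul] at bal0 bal1
  set s : ℝ := (m * p + n * q) / l with hs
  have hls : l * s = m * p + n * q := by rw [hs]; field_simp
  have hs0 : 0 < s := by positivity
  -- the law of cosines for the balanced triangle of unit vectors
  have hl2 : l ^ 2 = m ^ 2 + n ^ 2 + 2 * (m / p) * (n / q) *
      ((Y 0 - B 0) * (Y 0 - C 0) + (Y 1 - B 1) * (Y 1 - C 1)) := by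
    have h1 : l ^ 2 = (l / r * (Y 0 - A 0)) ^ 2 + (l / r * (Y 1 - A 1)) ^ 2 := by
      field_simp; linear_combination eA
    have h2 : m ^ 2 = (m / p * (Y 0 - B 0)) ^ 2 + (m / p * (Y 1 - B 1)) ^ 2 := by
      field_simp; linear_combination eB
    have h3 : n ^ 2 = (n / q * (Y 0 - C 0)) ^ 2 + (n / q * (Y 1 - C 1)) ^ 2 := by
      field_simp; linear_combination eC
    rw [bal0, bal1] at h1
    linear_combination h1 - h2 - h3
  set D : Plane := Y + (s / r) • (A - Y) with hD
  have D0 : D 0 = Y 0 - s / l * (m / p * (Y 0 - B 0) + n / q * (Y 0 - C 0)) := by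
    rw [← bal0]; simp [hD]; field_simp; ring
  have D1 : D 1 = Y 1 - s / l * (m / p * (Y 1 - B 1) + n / q * (Y 1 - C 1)) := by
    rw [← bal1]; simp [hD]; field_simp; ring
  have hsl : s / l = (m * p + n * q) / l ^ 2 := by rw [hs]; field_simp
  set κ := (Y 0 - B 0) * (Y 0 - C 0) + (Y 1 - B 1) * (Y 1 - C 1) with hκ
  have hBC : dist B C ^ 2 = p ^ 2 + q ^ 2 - 2 * κ := by
    rw [dist_sq_eq_coord, eB, eC, hκ]; ring
  have hκ' : κ = (l ^ 2 - m ^ 2 - n ^ 2) * (p * q) / (2 * m * n) := by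
    rw [hl2]; field_simp; ring
  have hBD : l * dist B D = n * dist B C := by
    refine (sq_eq_sq₀ (by positivity) (by positivity)).1 ?_
    have e : dist B D ^ 2 = (1 - s / l * (m / p)) ^ 2 * p ^ 2 + (s / l * (n / q)) ^ 2 * q ^ 2
        - 2 * (1 - s / l * (m / p)) * (s / l * (n / q)) * κ := by
      rw [dist_sq_eq_coord, D0, D1, eB, eC, hκ]; ring
    rw [mul_pow, mul_pow, e, hBC, hκ', hsl]
    field_simp; ring
  have hCD : l * dist C D = m * dist B C := by
    refine (sq_eq_sq₀ (by positivity) (by positivity)).1 ?_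
    have e : dist C D ^ 2 = (1 - s / l * (n / q)) ^ 2 * q ^ 2 + (s / l * (m / p)) ^ 2 * p ^ 2
        - 2 * (1 - s / l * (n / q)) * (s / l * (m / p)) * κ := by
      rw [dist_sq_eq_coord, D0, D1, eB, eC, hκ]; ring
    rw [mul_pow, mul_pow, e, hBC, hκ', hsl]
    field_simp; ring
  refine ⟨D, hBD, hCD, ?_⟩
  rcases le_or_gt r s with hrs | hrs
  · -- `A` is between `Y` and `D`; then the vertices do better unless `A = D`
    left
    by_contra hDA
    have hAD : dist D A = s - r := by
      have e : dist D A ^ 2 = (s - r) ^ 2 := by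
        rw [dist_sq_eq_coord]
        have : (s - r) ^ 2 = (s / r - 1) ^ 2 * r ^ 2 := by field_simp
        rw [this, eA]; simp [hD]; ring
      exact (sq_eq_sq₀ dist_nonneg (by linarith)).1 e
    have wB : Wbtw ℝ D A B := by
      rw [← dist_add_dist_eq_iff]
      refine le_antisymm ?_ (dist_triangle _ _ _)
      simp only [mixedFermat, dist_self, dist_comm C B] at gB
      refine le_of_mul_le_mul_left ?_ hl
      rw [hAD, dist_comm D B, hBD]
      linarith
    have wC : Wbtw ℝ D A C := by
      rw [← dist_add_dist_eq_iff]
      refine le_antisymm ?_ (dist_triangle _ _ _)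
      simp only [mixedFermat, dist_self] at gC
      refine le_of_mul_le_mul_left ?_ hl
      rw [hAD, dist_comm D C, hCD]
      linarith
    have cB := cross_eq_zero_of_wbtw wB
    have cC := cross_eq_zero_of_wbtw wC
    refine h (cross_eq_zero_of_common_line (Ne.symm hDA) ?_ ?_)
    · simp [cross] at cB ⊢; linarith
    · simp [cross] at cC ⊢; linarith
  · -- `D` is between `Y` and `A`; its barycentric coordinates come from the balance of forces
    right
    have hu : 0 < m / p := by positivity
    have hv : 0 < n / q := by positivity
    have hl4 : l < s * (m / p + n / q) := by
      refine lt_of_mul_lt_mul_left ?_ hl.le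
      have e : l * (s * (m / p + n / q)) = (m + n) ^ 2 + m * n * (p - q) ^ 2 / (p * q) := by
        rw [← mul_assoc, hls]; field_simp; ring
      have h5 : 0 ≤ m * n * (p - q) ^ 2 / (p * q) := by positivity
      have h6 : l ^ 2 < (m + n) ^ 2 := pow_lt_pow_left₀ hlt hl.le two_ne_zero
      rw [e, ← sq]
      linarith only [h5, h6]
    set w := m / p + n / q - l / r with hw
    have hw0 : 0 < w := by
      rw [hw, sub_pos, div_lt_iff₀ hr, mul_comm _ r]
      exact hl4.trans (mul_lt_mul_of_pos_right hrs (add_pos hu hv))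
    have h1 : 0 < 1 - s / r := by rw [sub_pos, div_lt_one hr]; exact hrs
    refine ⟨(1 - s / r) * (m / p) / w, (1 - s / r) * (n / q) / w, by positivity, by positivity,
      ?_, ?_⟩
    · rw [← add_div, ← mul_add, div_lt_one hw0, hw]
      have : l / r < s * (m / p + n / q) / r := by gcongr
      have e : s / r * (m / p + n / q) = s * (m / p + n / q) / r := by ring
      linarith only [this, e]
    · have aux : ∀ i : Fin 2, l / r * (Y i - A i) = m / p * (Y i - B i) + n / q * (Y i - C i) →
          D i = A i + ((1 - s / r) * (m / p) / w * (B i - A i) +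
            (1 - s / r) * (n / q) / w * (C i - A i)) := by
        intro i hi
        have hDi : D i = A i + (1 - s / r) * (Y i - A i) := by simp [hD]; ring
        have hYi : (Y i - A i) = (m / p * (B i - A i) + n / q * (C i - A i)) / w := by
          rw [eq_div_iff hw0.ne', hw]; linear_combination -hi
        rw [hDi, hYi]; ring
      apply plane_ext
      · simpa using aux 0 bal0
      · simpa using aux 1 bal1

/-! ### Triangles with prescribed angles and sides -/

/-- Heron's formula. -/
theorem four_mul_cross_sq (X Y Z : Plane) : 4 * cross (Y - X) (Z - X) ^ 2 =
    4 * dist X Y ^ 2 * dist Z X ^ 2 - (dist X Y ^ 2 + dist Z X ^ 2 - dist Y Z ^ 2) ^ 2 := by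
  simp only [dist_sq_eq_coord, cross, PiLp.sub_apply]; ring

theorem sin_angle_mul_dist_mul_dist (X Y Z : Plane) :
    Real.sin (∠ Y X Z) * (dist X Y * dist Z X) = |cross (Y - X) (Z - X)| := by
  rw [← sin_angle_mul_norm_mul_norm_eq_abs_cross, dist_comm X Y, dist_eq_norm, dist_eq_norm]
  rfl

/-- The law of sines. -/
theorem IsTriangleWithAngles.exists_dist_eq_mul_sin {X Y Z : Plane} {α β γ : ℝ}
    (h : IsTriangleWithAngles X Y Z α β γ) :
    0 < Real.sin α ∧ 0 < Real.sin β ∧ 0 < Real.sin γ ∧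
      ∃ k : ℝ, 0 < k ∧ dist Y Z = k * Real.sin α ∧ dist Z X = k * Real.sin β ∧
        dist X Y = k * Real.sin γ := by
  obtain ⟨hi, rfl, rfl, rfl⟩ := h
  rw [affineIndependent_iff_cross] at hi
  obtain ⟨h1, h2, h3⟩ := vertex_ne_of_cross hi
  have a1 := sin_angle_mul_dist_mul_dist X Y Z
  have a2 := sin_angle_mul_dist_mul_dist Y Z X
  have a3 := sin_angle_mul_dist_mul_dist Z X Y
  have e2 : cross (Z - Y) (X - Y) = cross (Y - X) (Z - X) := by simp [cross]; ring
  have e3 : cross (X - Z) (Y - Z) = cross (Y - X) (Z - X) := by simp [cross]; ring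
  rw [e2, angle_comm] at a2
  rw [e3] at a3
  have p1 : 0 < dist X Y := dist_pos.2 h1
  have p2 : 0 < dist Z X := dist_pos.2 h2.symm
  have p3 : 0 < dist Y Z := dist_pos.2 h3
  have hc : 0 < |cross (Y - X) (Z - X)| := abs_pos.2 hi
  have s1 : Real.sin (∠ Y X Z) = |cross (Y - X) (Z - X)| / (dist X Y * dist Z X) := by
    rw [← a1]; field_simp
  have s2 : Real.sin (∠ X Y Z) = |cross (Y - X) (Z - X)| / (dist Y Z * dist X Y) := by
    rw [← a2]; field_simp
  have s3 : Real.sin (∠ X Z Y) = |cross (Y - X) (Z - X)| / (dist Z X * dist Y Z) := by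
    rw [← a3]; field_simp
  refine ⟨by rw [s1]; positivity, by rw [s2]; positivity, by rw [s3]; positivity,
    dist X Y * dist Z X * dist Y Z / |cross (Y - X) (Z - X)|, by positivity, ?_, ?_, ?_⟩
  · rw [s1]; field_simp
  · rw [s2]; field_simp
  · rw [s3]; field_simp

theorem AreAnglesOfSides.exists_eq_mul_sin {l m n α β γ : ℝ} (h : AreAnglesOfSides l m n α β γ) :
    0 < Real.sin α ∧ 0 < Real.sin β ∧ 0 < Real.sin γ ∧
      ∃ k : ℝ, 0 < k ∧ l = k * Real.sin α ∧ m = k * Real.sin β ∧ n = k * Real.sin γ := by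
  obtain ⟨X, Y, Z, rfl, rfl, rfl, hT⟩ := h
  exact hT.exists_dist_eq_mul_sin

theorem angle_eq_of_dist_eq_mul {X Y Z X' Y' Z' : Plane} {k : ℝ} (hk : 0 < k)
    (h1 : dist X' Y' = k * dist X Y) (h2 : dist Z' X' = k * dist Z X)
    (h3 : dist Y' Z' = k * dist Y Z) (hXY : X ≠ Y) (hXZ : X ≠ Z) : ∠ Y' X' Z' = ∠ Y X Z := by
  have c := law_cos Y X Z
  have c' := law_cos Y' X' Z'
  rw [dist_comm Y' X', h1, h2, h3] at c'
  rw [dist_comm Y X] at c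
  have p1 : 0 < dist X Y := dist_pos.2 hXY
  have p2 : 0 < dist Z X := dist_pos.2 hXZ.symm
  refine Real.injOn_cos ⟨angle_nonneg _ _ _, angle_le_pi _ _ _⟩
    ⟨angle_nonneg _ _ _, angle_le_pi _ _ _⟩ ?_
  refine mul_left_cancel₀ (a := 2 * k ^ 2 * (dist X Y * dist Z X)) (by positivity) ?_
  linear_combination c' - k ^ 2 * c

theorem IsTriangleWithAngles.of_dist_eq_mul {l m n α β γ : ℝ} (h : AreAnglesOfSides l m n α β γ)
    {X Y Z : Plane} {k : ℝ} (hk : 0 < k) (h1 : dist Y Z = k * l) (h2 : dist Z X = k * m)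
    (h3 : dist X Y = k * n) : IsTriangleWithAngles X Y Z α β γ := by
  obtain ⟨X', Y', Z', rfl, rfl, rfl, hi, rfl, rfl, rfl⟩ := h
  rw [affineIndependent_iff_cross] at hi
  obtain ⟨n1, n2, n3⟩ := vertex_ne_of_cross hi
  refine ⟨?_, ?_, ?_, ?_⟩
  · rw [affineIndependent_iff_cross]
    intro h0
    have e := four_mul_cross_sq X Y Z
    have e' := four_mul_cross_sq X' Y' Z'
    rw [h0, h1, h2, h3] at e
    have : k ^ 4 * cross (Y' - X') (Z' - X') ^ 2 = 0 := by linear_combination (k ^ 4 * e' - e) / 4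
    have hp : 0 < k ^ 4 * cross (Y' - X') (Z' - X') ^ 2 := by positivity
    exact hp.ne' this
  · exact angle_eq_of_dist_eq_mul hk h3 h2 h1 n1 n2
  · rw [angle_comm, angle_comm X']
    exact angle_eq_of_dist_eq_mul hk h1 h3 h2 n3 n1.symm
  · exact angle_eq_of_dist_eq_mul hk h2 h1 h3 n2.symm n3.symm

/-- On each side of a segment `B C` there is a triangle with sides proportional to `l`, `m`, `n`
and base `B C`. -/
theorem exists_apex {A B C : Plane} (h : cross (B - A) (C - A) ≠ 0) {l m n : ℝ} (hl : 0 < l)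
    (hm : 0 < m) (hn : 0 < n) (h1 : l < m + n) (h2 : m < n + l) (h3 : n < l + m) :
    ∃ D : Plane, l * dist B D = n * dist B C ∧ l * dist C D = m * dist B C ∧
      0 < cross (B - A) (C - A) * cross (B - D) (C - D) := by
  obtain ⟨-, -, hBC⟩ := vertex_ne_of_cross h
  have ha : 0 < dist B C := dist_pos.2 hBC
  set τ := (n ^ 2 + l ^ 2 - m ^ 2) / (2 * l ^ 2) with hτ
  have hpos : 0 < n ^ 2 / l ^ 2 - τ ^ 2 := by
    have : n ^ 2 / l ^ 2 - τ ^ 2 = ((m + n - l) * (n + l - m) * (l + m - n) * (l + m + n)) /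
        (4 * l ^ 4) := by rw [hτ]; field_simp; ring
    rw [this]
    have := mul_pos (sub_pos.2 h1) (sub_pos.2 h2)
    have := mul_pos this (sub_pos.2 h3)
    positivity
  -- the height of the triangle, signed so that the apex is on `A`'s side of the base
  obtain ⟨η, hη2, hη⟩ : ∃ η : ℝ, η ^ 2 = n ^ 2 / l ^ 2 - τ ^ 2 ∧
      0 < cross (B - A) (C - A) * η := by
    have hs := Real.sqrt_pos.2 hpos
    rcases lt_or_gt_of_ne h with hc | hc
    · refine ⟨-√(n ^ 2 / l ^ 2 - τ ^ 2), by rw [neg_sq, Real.sq_sqrt hpos.le], ?_⟩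
      nlinarith
    · exact ⟨√(n ^ 2 / l ^ 2 - τ ^ 2), Real.sq_sqrt hpos.le, mul_pos hc hs⟩
  have eBC := dist_sq_eq_coord B C
  refine ⟨!₂[B 0 + τ * (C 0 - B 0) - η * (C 1 - B 1), B 1 + τ * (C 1 - B 1) + η * (C 0 - B 0)],
    ?_, ?_, ?_⟩
  · refine (sq_eq_sq₀ (by positivity) (by positivity)).1 ?_
    rw [mul_pow, mul_pow, dist_sq_eq_coord]
    simp
    have : n ^ 2 = l ^ 2 * (τ ^ 2 + η ^ 2) := by rw [hη2]; field_simp; ring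
    rw [this, eBC]; ring
  · refine (sq_eq_sq₀ (by positivity) (by positivity)).1 ?_
    rw [mul_pow, mul_pow, dist_sq_eq_coord]
    simp
    have : m ^ 2 = l ^ 2 * ((1 - τ) ^ 2 + η ^ 2) := by
      rw [hη2, hτ]; field_simp; ring
    rw [this, eBC]; ring
  · have : cross (B - A) (C - A) * cross (B - !₂[B 0 + τ * (C 0 - B 0) - η * (C 1 - B 1),
        B 1 + τ * (C 1 - B 1) + η * (C 0 - B 0)]) (C - !₂[B 0 + τ * (C 0 - B 0) -
        η * (C 1 - B 1), B 1 + τ * (C 1 - B 1) + η * (C 0 - B 0)]) =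
        cross (B - A) (C - A) * η * dist B C ^ 2 := by
      rw [eBC]; simp [cross]; ring
    rw [this]; positivity

/-- The vertex of a triangle is determined by its base, the other two sides, and the side of the
base on which it lies. -/
theorem apex_unique {B C D E : Plane} (hBC : B ≠ C) (hB : dist B D = dist B E)
    (hC : dist C D = dist C E) (h : 0 < cross (B - D) (C - D) * cross (B - E) (C - E)) :
    D = E := by
  have e1 := dist_sq_eq_coord B D
  have e2 := dist_sq_eq_coord C D
  rw [hB, dist_sq_eq_coord] at e1
  rw [hC, dist_sq_eq_coord] at e2
  have ha : 0 < dist B C ^ 2 := by have := dist_pos.2 hBC; positivity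
  rw [dist_sq_eq_coord] at ha
  have hc : cross (B - D) (C - D) = cross (B - E) (C - E) := by
    have : cross (B - D) (C - D) ^ 2 = cross (B - E) (C - E) ^ 2 := by
      have f1 := four_mul_cross_sq D B C
      have f2 := four_mul_cross_sq E B C
      rw [dist_comm D B, hB, hC] at f1
      rw [dist_comm E B] at f2
      linarith
    rcases sq_eq_sq_iff_eq_or_eq_neg.1 this with h' | h'
    · exact h'
    · rw [h'] at h; nlinarith [sq_nonneg (cross (B - E) (C - E))]
  have hi : (C 0 - B 0) * (D 0 - E 0) + (C 1 - B 1) * (D 1 - E 1) = 0 := by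
    linear_combination (e2 - e1) / 2
  have hc' : (C 0 - B 0) * (D 1 - E 1) - (C 1 - B 1) * (D 0 - E 0) = 0 := by
    simp [cross] at hc; linear_combination hc
  apply plane_ext
  · refine mul_left_cancel₀ ha.ne' ?_
    linear_combination (C 0 - B 0) * hi - (C 1 - B 1) * hc'
  · refine mul_left_cancel₀ ha.ne' ?_
    linear_combination (C 1 - B 1) * hi + (C 0 - B 0) * hc'

theorem exists_areAnglesOfSides {l m n : ℝ} (hl : 0 < l) (hm : 0 < m) (hn : 0 < n)
    (h1 : l < m + n) (h2 : m < n + l) (h3 : n < l + m) :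
    ∃ α β γ : ℝ, AreAnglesOfSides l m n α β γ := by
  have h : cross (!₂[0, 0] - !₂[0, 1]) (!₂[l, 0] - !₂[0, 1]) ≠ 0 := by
    simp [cross]; exact hl.ne'
  obtain ⟨D, hB, hC, hD⟩ := exists_apex h hl hm hn h1 h2 h3
  have hBC : dist (!₂[0, 0] : Plane) !₂[l, 0] = l := by
    refine (sq_eq_sq₀ dist_nonneg hl.le).1 ?_
    rw [dist_sq_eq_coord]; simp
  rw [hBC, mul_comm n] at hB
  rw [hBC, mul_comm m] at hC
  refine ⟨_, _, _, D, !₂[0, 0], !₂[l, 0], hBC, mul_left_cancel₀ hl.ne' hC, ?_, ?_, rfl, rfl, rfl⟩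
  · rw [dist_comm]; exact mul_left_cancel₀ hl.ne' hB
  · rw [affineIndependent_iff_cross]
    intro h0; rw [h0] at hD; simp at hD

/-- The apex `D` sees the base `B C` under the angle opposite to `l`, and has the angles opposite
to `m` at `B` and `n` at `C`. -/
theorem isTriangleWithAngles_apex {B C D : Plane} {l m n α β γ : ℝ} (hl : 0 < l) (hBC : B ≠ C)
    (h : AreAnglesOfSides l m n α β γ) (hB : l * dist B D = n * dist B C)
    (hC : l * dist C D = m * dist B C) : IsTriangleWithAngles D B C α β γ := by
  have ha : 0 < dist B C := dist_pos.2 hBC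
  refine .of_dist_eq_mul h (k := dist B C / l) (by positivity) ?_ ?_ ?_
  · field_simp
  · field_simp; linarith
  · rw [dist_comm]; field_simp; linarith

/-- For a point `D` on `A`'s side of the line `B C`, the angle `D B C` is smaller than `A B C`
exactly when `D` is on `C`'s side of the line `A B`. -/
theorem angle_lt_angle_iff_pos {A B C : Plane} (h : cross (B - A) (C - A) ≠ 0) {y z : ℝ}
    (hyz : y + z < 1) :
    ∠ (A + (y • (B - A) + z • (C - A))) B C < ∠ A B C ↔ 0 < z := by
  have h' : cross (A - B) (C - B) ≠ 0 := by
    intro h0; apply h; simp [cross] at h0 ⊢; linarith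
  rw [← angle_smul_add_smul_lt_iff h' (sub_pos.2 hyz)]
  unfold EuclideanGeometry.angle
  have : A + (y • (B - A) + z • (C - A)) -ᵥ B = (1 - (y + z)) • (A - B) + z • (C - B) := by
    rw [vsub_eq_sub]; module
  rw [this]; rfl

theorem angle_lt_angle_iff_pos' {A B C : Plane} (h : cross (B - A) (C - A) ≠ 0) {y z : ℝ}
    (hyz : y + z < 1) :
    ∠ (A + (y • (B - A) + z • (C - A))) C B < ∠ A C B ↔ 0 < y := by
  rw [add_comm (y • _)]
  exact angle_lt_angle_iff_pos (cross_swap_ne_zero h) (by linarith)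

/-! ### The circumscribed circle -/

theorem dist_triCircumcenter {A B C : Plane} (hABC : AffineIndependent ℝ ![A, B, C]) :
    dist A (triCircumcenter A B C hABC) = triCircumradius A B C hABC ∧
    dist B (triCircumcenter A B C hABC) = triCircumradius A B C hABC ∧
    dist C (triCircumcenter A B C hABC) = triCircumradius A B C hABC :=
  ⟨(mkTriangle A B C hABC).dist_circumcenter_eq_circumradius 0,
    (mkTriangle A B C hABC).dist_circumcenter_eq_circumradius 1,
    (mkTriangle A B C hABC).dist_circumcenter_eq_circumradius 2⟩

/-- The power of a point with respect to the circumscribed circle, in barycentric coordinates. -/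
theorem power_triCircumcenter {A B C : Plane} (hABC : AffineIndependent ℝ ![A, B, C]) (y z : ℝ) :
    dist (A + (y • (B - A) + z • (C - A))) (triCircumcenter A B C hABC) ^ 2 -
        triCircumradius A B C hABC ^ 2 =
      ‖y • (B - A) + z • (C - A)‖ ^ 2 - y * dist A B ^ 2 - z * dist C A ^ 2 := by
  obtain ⟨hA, hB, hC⟩ := dist_triCircumcenter hABC
  have hA := congrArg (· ^ 2) hA
  have hB := congrArg (· ^ 2) hB
  have hC := congrArg (· ^ 2) hC
  simp only [dist_sq_eq_coord, norm_sq_eq_coord, PiLp.add_apply, PiLp.smul_apply, PiLp.sub_apply,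
    smul_eq_mul] at *
  linear_combination (1 - y - z) * hA + y * hB + z * hC

/-- The power of `Y` with respect to the circle `A B C`, in terms of the angle at which `Y` sees
`B C`. -/
theorem cross_mul_power_triCircumcenter {A B C : Plane}
    (hABC : AffineIndependent ℝ ![A, B, C]) (Y : Plane) :
    cross (B - A) (C - A) * (dist Y (triCircumcenter A B C hABC) ^ 2 -
        triCircumradius A B C hABC ^ 2) =
      cross (B - A) (C - A) * inner ℝ (B - Y) (C - Y) -
        inner ℝ (B - A) (C - A) * cross (B - Y) (C - Y) := by
  have h := (affineIndependent_iff_cross _ _ _).1 hABC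
  have hY := eq_smul_add_smul_of_cross_ne_zero h (Y - A)
  generalize cross (Y - A) (C - A) / cross (B - A) (C - A) = y at hY
  generalize cross (B - A) (Y - A) / cross (B - A) (C - A) = z at hY
  obtain rfl : Y = A + (y • (B - A) + z • (C - A)) := by rw [← hY]; abel
  rw [power_triCircumcenter]
  simp only [inner_eq_coord, cross, dist_sq_eq_coord, norm_sq_eq_coord, PiLp.add_apply,
    PiLp.smul_apply, PiLp.sub_apply, smul_eq_mul]
  ring

theorem triCircumradius_nonneg {A B C : Plane} (hABC : AffineIndependent ℝ ![A, B, C]) :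
    0 ≤ triCircumradius A B C hABC := by
  rw [← (dist_triCircumcenter hABC).1]; exact dist_nonneg

theorem dist_eq_triCircumradius_iff {A B C : Plane} (hABC : AffineIndependent ℝ ![A, B, C])
    (Y : Plane) : dist Y (triCircumcenter A B C hABC) = triCircumradius A B C hABC ↔
      cross (B - A) (C - A) * inner ℝ (B - Y) (C - Y) =
        inner ℝ (B - A) (C - A) * cross (B - Y) (C - Y) := by
  have h := (affineIndependent_iff_cross _ _ _).1 hABC
  rw [← sub_eq_zero (a := _ * _), ← cross_mul_power_triCircumcenter hABC, mul_eq_zero,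
    or_iff_right h, sub_eq_zero, sq_eq_sq₀ dist_nonneg (triCircumradius_nonneg hABC)]

theorem mem_arcBC_iff {A B C : Plane} (hABC : AffineIndependent ℝ ![A, B, C]) (Y : Plane) :
    Y ∈ arcBC A B C hABC ↔ cross (B - A) (C - A) * cross (B - Y) (C - Y) ≤ 0 ∧
      cross (B - A) (C - A) * inner ℝ (B - Y) (C - Y) =
        inner ℝ (B - A) (C - A) * cross (B - Y) (C - Y) := by
  have h := (affineIndependent_iff_cross _ _ _).1 hABC
  have e : ∀ X : Plane, cross (C - B) (X - B) = cross (B - X) (C - X) := by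
    intro X; simp [cross]; ring
  rw [arcBC, Set.mem_ofPred_eq, wOppSide_line_iff (vertex_ne_of_cross h).2.2, e, e,
    dist_eq_triCircumradius_iff, and_comm]

/-! ### Weights proportional to the sides -/

theorem minimizers_eq_arcBC {A B C : Plane} (hABC : AffineIndependent ℝ ![A, B, C]) {l m n : ℝ}
    (hl : 0 < l) (hB : l * dist B A = n * dist B C) (hC : l * dist C A = m * dist B C) :
    minimizers (mixedFermat A B C l m n) = arcBC A B C hABC ∧
      ∀ Y ∈ arcBC A B C hABC, mixedFermat A B C l m n Y = 0 := by
  have h := (affineIndependent_iff_cross _ _ _).1 hABC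
  have key := mul_dist_sub_le_mixedFermat (A := A) hl (vertex_ne_of_cross h).2.2 h hB hC
  simp only [sub_self, mul_zero, ← mem_arcBC_iff hABC] at key
  refine ⟨Set.ext fun Y => ⟨fun hY => ?_, fun hY Z => ?_⟩, fun Y hY => (key Y).2.2 hY⟩
  · have hBarc : B ∈ arcBC A B C hABC := by rw [mem_arcBC_iff]; simp [cross]
    refine (key Y).2.1 (le_antisymm ?_ (key Y).1)
    rw [← (key B).2.2 hBarc]
    exact hY B
  · rw [(key Y).2.2 hY]
    exact (key Z).1

/-! ### Minimizers at the vertices -/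

/-- Unless the triangle with sides `l`, `m`, `n` has the angles of `A B C` at `B` and `C`, or
smaller angles at both, only `B` and `C` can be minimizers. -/
theorem minimizers_subset_pair {A B C : Plane} (h : cross (B - A) (C - A) ≠ 0)
    {l m n α₁ β₁ γ₁ : ℝ} (hl : 0 < l) (hm : 0 < m) (hn : 0 < n) (hlt : l < m + n)
    (hnt : n < l + m) (hT : AreAnglesOfSides l m n α₁ β₁ γ₁)
    (h1 : ¬ (β₁ = ∠ A B C ∧ γ₁ = ∠ A C B)) (h2 : ¬ (β₁ < ∠ A B C ∧ γ₁ < ∠ A C B)) :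
    minimizers (mixedFermat A B C l m n) ⊆ {B, C} := by
  intro Y hY
  by_contra hYBC
  simp only [Set.mem_insert_iff, Set.mem_singleton_iff, not_or] at hYBC
  have hYA : Y ≠ A := by
    rintro rfl
    exact left_notMem_minimizers h hn (by linarith) hY
  obtain ⟨D, hB, hC, hD⟩ :=
    exists_apex_of_mem_minimizers h hl hm hn hlt hY hYA hYBC.1 hYBC.2
  obtain ⟨-, -, e2, e3⟩ := isTriangleWithAngles_apex hl (vertex_ne_of_cross h).2.2 hT hB hC
  rcases hD with rfl | ⟨y, z, hy, hz, hyz, rfl⟩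
  · exact h1 ⟨e2.symm, e3.symm⟩
  · rw [← e2, ← e3] at h2
    exact h2 ⟨(angle_lt_angle_iff_pos h hyz).2 hz, (angle_lt_angle_iff_pos' h hyz).2 hy⟩

theorem minimizers_eq_left_of_subset_pair {f : Plane → ℝ} {B C : Plane}
    (hne : (minimizers f).Nonempty) (hs : minimizers f ⊆ {B, C}) (h : f B < f C) :
    minimizers f = {B} := by
  have hC : C ∉ minimizers f := fun hC => absurd (hC B) (not_le.2 h)
  refine (hne.subset_singleton_iff).1 fun Y hY => ?_
  rcases hs hY with rfl | rfl
  · rfl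
  · exact absurd hY hC

theorem minimizers_eq_pair_of_subset_pair {f : Plane → ℝ} {B C : Plane}
    (hne : (minimizers f).Nonempty) (hs : minimizers f ⊆ {B, C}) (h : f B = f C) :
    minimizers f = {B, C} := by
  refine hs.antisymm ?_
  obtain ⟨Y, hY⟩ := hne
  have hf : ∀ Z, f B ≤ f Z := by
    rcases hs hY with rfl | rfl
    · exact hY
    · rw [h]; exact hY
  rintro Z (rfl | rfl)
  · exact hf
  · intro W; rw [← h]; exact hf W

/-! ### The interior minimizer -/

theorem cross_sub_ray (A B C : Plane) (y z t : ℝ) :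
    cross (B - (A + t • (y • (B - A) + z • (C - A))))
      (C - (A + t • (y • (B - A) + z • (C - A)))) =
      (1 - t * (y + z)) * cross (B - A) (C - A) := by
  simp [cross]; ring

theorem norm_sq_smul_add_smul (A B C : Plane) (y z : ℝ) :
    ‖y • (B - A) + z • (C - A)‖ ^ 2 = y ^ 2 * dist A B ^ 2 +
      2 * y * z * inner ℝ (B - A) (C - A) + z ^ 2 * dist C A ^ 2 := by
  rw [norm_sq_eq_coord, dist_sq_eq_coord, dist_sq_eq_coord, inner_eq_coord]; simp; ring

theorem dist_sq_eq_gram (A B C : Plane) : dist B C ^ 2 =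
    dist A B ^ 2 + dist C A ^ 2 - 2 * inner ℝ (B - A) (C - A) := by
  simp only [dist_sq_eq_coord, inner_eq_coord, PiLp.sub_apply]; ring

/-- The ratio `A Q / A D` for the second intersection `Q` of the line `A D` with the circle
`B C D`, where `D = A + y (B - A) + z (C - A)`. -/
noncomputable def rayParam (A B C : Plane) (y z : ℝ) : ℝ :=
  (y * dist A B ^ 2 + z * dist C A ^ 2 - ‖y • (B - A) + z • (C - A)‖ ^ 2) /
    ((1 - (y + z)) * ‖y • (B - A) + z • (C - A)‖ ^ 2)

theorem norm_sq_pos_of_pos {A B C : Plane} (h : cross (B - A) (C - A) ≠ 0) {y z : ℝ} (hy : 0 < y) :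
    0 < ‖y • (B - A) + z • (C - A)‖ ^ 2 := by
  have : y • (B - A) + z • (C - A) ≠ 0 := by
    intro h0
    have h2 : cross (y • (B - A) + z • (C - A)) (C - A) = y * cross (B - A) (C - A) := by
      simp [cross]; ring
    rw [h0] at h2
    have h3 : y * cross (B - A) (C - A) ≠ 0 := mul_ne_zero hy.ne' h
    apply h3; rw [← h2]; simp [cross]
  positivity

theorem norm_sq_lt_of_pos {A B C : Plane} (h : cross (B - A) (C - A) ≠ 0)
    {y z : ℝ} (hy : 0 < y) (hz : 0 < z) :
    ‖y • (B - A) + z • (C - A)‖ ^ 2 < (y + z) * (y * dist A B ^ 2 + z * dist C A ^ 2) := by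
  have ha : 0 < dist B C := dist_pos.2 (vertex_ne_of_cross h).2.2
  have : (y + z) * (y * dist A B ^ 2 + z * dist C A ^ 2) - ‖y • (B - A) + z • (C - A)‖ ^ 2 =
      y * z * dist B C ^ 2 := by
    rw [norm_sq_smul_add_smul, dist_sq_eq_gram A B C]; ring
  rw [← sub_pos, this]; positivity

theorem one_lt_rayParam_mul {A B C : Plane} (h : cross (B - A) (C - A) ≠ 0)
    {y z : ℝ} (hy : 0 < y) (hz : 0 < z)
    (hyz : y + z < 1) : 1 < rayParam A B C y z * (y + z) := by
  have hN := norm_sq_pos_of_pos h (z := z) hy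
  have hlt := norm_sq_lt_of_pos h hy hz
  have hs : 0 < 1 - (y + z) := by linarith
  rw [rayParam, div_mul_eq_mul_div, one_lt_div (by positivity)]
  linarith

theorem one_lt_rayParam {A B C : Plane} (h : cross (B - A) (C - A) ≠ 0)
    {y z : ℝ} (hy : 0 < y) (hz : 0 < z)
    (hyz : y + z < 1) : 1 < rayParam A B C y z := by
  have := one_lt_rayParam_mul h hy hz hyz
  by_contra hle
  push Not at hle
  nlinarith [mul_le_mul_of_nonneg_right hle (add_pos hy hz).le]

/-- The ray from `A` through `D` meets the circle `B C D` at the parameters `1` and `rayParam`. -/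
theorem concyclic_ray_iff {A B C : Plane} (h : cross (B - A) (C - A) ≠ 0) {y z : ℝ} (hy : 0 < y)
    (hyz : y + z < 1) (t : ℝ) :
    (1 - (y + z)) * cross (B - A) (C - A) *
        inner ℝ (B - (A + t • (y • (B - A) + z • (C - A))))
          (C - (A + t • (y • (B - A) + z • (C - A)))) =
      inner ℝ (B - (A + (y • (B - A) + z • (C - A)))) (C - (A + (y • (B - A) + z • (C - A)))) *
        ((1 - t * (y + z)) * cross (B - A) (C - A)) ↔ t = 1 ∨ t = rayParam A B C y z := by
  have hN := norm_sq_pos_of_pos h (z := z) hy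
  have hs : 0 < 1 - (y + z) := by linarith
  have hr : rayParam A B C y z * ((1 - (y + z)) * ‖y • (B - A) + z • (C - A)‖ ^ 2) =
      y * dist A B ^ 2 + z * dist C A ^ 2 - ‖y • (B - A) + z • (C - A)‖ ^ 2 := by
    exact div_mul_cancel₀ _ (mul_pos hs hN).ne'
  have e : (1 - (y + z)) * cross (B - A) (C - A) *
        inner ℝ (B - (A + t • (y • (B - A) + z • (C - A))))
          (C - (A + t • (y • (B - A) + z • (C - A)))) -
      inner ℝ (B - (A + (y • (B - A) + z • (C - A)))) (C - (A + (y • (B - A) + z • (C - A)))) *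
        ((1 - t * (y + z)) * cross (B - A) (C - A)) =
      cross (B - A) (C - A) * ((1 - (y + z)) * ‖y • (B - A) + z • (C - A)‖ ^ 2) *
        ((t - 1) * (t - rayParam A B C y z)) := by
    have : cross (B - A) (C - A) * ((1 - (y + z)) * ‖y • (B - A) + z • (C - A)‖ ^ 2) *
        ((t - 1) * (t - rayParam A B C y z)) = cross (B - A) (C - A) * (t - 1) *
        (t * ((1 - (y + z)) * ‖y • (B - A) + z • (C - A)‖ ^ 2) -
          (y * dist A B ^ 2 + z * dist C A ^ 2 - ‖y • (B - A) + z • (C - A)‖ ^ 2)) := by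
      rw [← hr]; ring
    rw [this]
    simp only [inner_eq_coord, cross, dist_sq_eq_coord, norm_sq_eq_coord, PiLp.add_apply,
      PiLp.smul_apply, PiLp.sub_apply, smul_eq_mul]
    ring
  have hne : cross (B - A) (C - A) * ((1 - (y + z)) * ‖y • (B - A) + z • (C - A)‖ ^ 2) ≠ 0 :=
    mul_ne_zero h (by positivity)
  rw [← sub_eq_zero, e, mul_eq_zero, or_iff_right hne, mul_eq_zero, sub_eq_zero, sub_eq_zero]

/-- If the apex `D` of the triangle with sides proportional to `l`, `m`, `n` is inside `A B C`, the
objective is bounded below by `l (DY - AY) ≥ -l AD`, and both bounds are attained only at the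
second intersection of the line `A D` with the circle `B C D`. -/
theorem minimizers_eq_singleton_ray {A B C : Plane} (h : cross (B - A) (C - A) ≠ 0)
    {l m n y z : ℝ} (hl : 0 < l) (hy : 0 < y) (hz : 0 < z) (hyz : y + z < 1)
    (hB : l * dist B (A + (y • (B - A) + z • (C - A))) = n * dist B C)
    (hC : l * dist C (A + (y • (B - A) + z • (C - A))) = m * dist B C) :
    minimizers (mixedFermat A B C l m n) =
        {A + rayParam A B C y z • (y • (B - A) + z • (C - A))} ∧
      mixedFermat A B C l m n (A + rayParam A B C y z • (y • (B - A) + z • (C - A))) =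
        -l * ‖y • (B - A) + z • (C - A)‖ := by
  have e1 := cross_sub_ray A B C y z 1
  rw [one_smul, one_mul] at e1
  have hs : 0 < 1 - (y + z) := by linarith
  have hδ : cross (B - (A + (y • (B - A) + z • (C - A))))
      (C - (A + (y • (B - A) + z • (C - A)))) ≠ 0 := by
    rw [e1]; exact mul_ne_zero hs.ne' h
  have key := mul_dist_sub_le_mixedFermat (A := A) hl (vertex_ne_of_cross h).2.2 hδ hB hC
  have hN := norm_sq_pos_of_pos h (z := z) hy
  have hcirc := concyclic_ray_iff h hy hyz (z := z)
  have hr1 := one_lt_rayParam h hy hz hyz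
  have hr2 := one_lt_rayParam_mul h hy hz hyz
  have hside : ∀ t : ℝ, cross (B - (A + (y • (B - A) + z • (C - A))))
      (C - (A + (y • (B - A) + z • (C - A)))) *
      cross (B - (A + t • (y • (B - A) + z • (C - A))))
        (C - (A + t • (y • (B - A) + z • (C - A)))) ≤ 0 ↔ 1 ≤ t * (y + z) := by
    intro t
    rw [e1, cross_sub_ray]
    have hp : 0 < (1 - (y + z)) * cross (B - A) (C - A) ^ 2 := by positivity
    rw [show (1 - (y + z)) * cross (B - A) (C - A) *
      ((1 - t * (y + z)) * cross (B - A) (C - A)) =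
      (1 - (y + z)) * cross (B - A) (C - A) ^ 2 * (1 - t * (y + z)) by ring,
      mul_nonpos_iff_pos_imp_nonpos]
    constructor
    · intro hh; linarith [hh.1 hp]
    · intro hh; exact ⟨fun _ => by linarith, fun _ => hp.le⟩
  set v := y • (B - A) + z • (C - A) with hv
  set D := A + v with hD
  set Q := A + rayParam A B C y z • v with hQ
  have hAD : dist D A = ‖v‖ := by rw [dist_eq_norm, hD, add_sub_cancel_left]
  have low : ∀ Y, -l * ‖v‖ ≤ l * (dist D Y - dist A Y) := by
    intro Y
    have := dist_triangle A D Y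
    rw [dist_comm A D, hAD] at this
    nlinarith
  -- at `Q` Ptolemy's inequality is an equality, and `D` is between `A` and `Q`
  have hQval : mixedFermat A B C l m n Q = -l * ‖v‖ := by
    have : mixedFermat A B C l m n Q = l * (dist D Q - dist A Q) := by
      refine (key Q).2.2 ⟨(hside _).2 hr2.le, ?_⟩
      have := (hcirc (rayParam A B C y z)).2 (Or.inr rfl)
      rwa [← e1, ← cross_sub_ray] at this
    have d1 : dist D Q = (rayParam A B C y z - 1) * ‖v‖ := by
      rw [dist_comm, dist_eq_norm, show Q - D = (rayParam A B C y z - 1) • v by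
        rw [hQ, hD]; module, norm_smul, Real.norm_of_nonneg (by linarith)]
    have d2 : dist A Q = rayParam A B C y z * ‖v‖ := by
      rw [dist_comm, dist_eq_norm, hQ, add_sub_cancel_left, norm_smul,
        Real.norm_of_nonneg (by linarith)]
    rw [this, d1, d2]; ring
  refine ⟨Set.ext fun Y => ⟨fun hY => ?_, ?_⟩, hQval⟩
  · -- equality in the second bound puts `Y` on the ray from `A` through `D`, beyond `D`
    have hle := hY Q
    rw [hQval] at hle
    have k1 := (key Y).1
    have k2 := low Y
    have hpt := (key Y).2.1 (le_antisymm (hle.trans k2) k1)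
    have hw : Wbtw ℝ A D Y := by
      rw [← dist_add_dist_eq_iff, dist_comm A D, hAD]
      refine mul_left_cancel₀ hl.ne' ?_
      linarith
    obtain ⟨r, ⟨hr0, -⟩, hrY⟩ := hw
    have hrv : r • (Y - A) = v := by
      rw [AffineMap.lineMap_apply, vsub_eq_sub, vadd_eq_add, hD, add_comm] at hrY
      exact add_left_cancel hrY
    have hrne : r ≠ 0 := by
      rintro rfl
      rw [zero_smul] at hrv
      rw [← hrv] at hN; simp at hN
    have hYr : Y = A + r⁻¹ • v := by rw [← hrv, inv_smul_smul₀ hrne]; abel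
    rw [hYr, hside, e1, cross_sub_ray, hcirc] at hpt
    rcases hpt.2 with h1 | h1
    · rw [h1] at hpt; linarith [hpt.1]
    · rw [Set.mem_singleton_iff, hYr, h1]
  · rintro rfl Z
    rw [hQval]
    exact (low Z).trans (key Z).1

/-! ### Feet of perpendiculars, reflections and isogonality in coordinates -/

theorem foot_eq (U V M : Plane) :
    foot U V M = U + (inner ℝ (V - U) (M - U) / ‖V - U‖ ^ 2) • (V - U) := by
  unfold foot
  rw [EuclideanGeometry.coe_orthogonalProjection_eq_iff_mem]
  constructor
  · have := AffineMap.lineMap_mem_affineSpan_pair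
      (inner ℝ (V - U) (M - U) / ‖V - U‖ ^ 2) U V
    rwa [AffineMap.lineMap_apply, vsub_eq_sub, vadd_eq_add, add_comm] at this
  · rw [direction_affineSpan, vectorSpan_pair_rev,
      Submodule.mem_orthogonal_singleton_iff_inner_right, vsub_eq_sub,
      vsub_eq_sub, sub_add_eq_sub_sub, inner_sub_right, real_inner_smul_right,
      real_inner_self_eq_norm_sq]
    by_cases h : V - U = 0
    · simp [h]
    · rw [div_mul_cancel₀ _ (by simpa using h), sub_self]

theorem foot_comm (U V M : Plane) : foot U V M = foot V U M := by
  simp only [foot, Set.pair_comm U V]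

/-- Isogonality at `V` as a polynomial condition: as complex numbers, `(X - V) (Y - V)` is a real
multiple of `(U - V) (W - V)`. -/
theorem areIsogonalAt_iff {U V W X Y : Plane} (h : cross (U - V) (W - V) ≠ 0) :
    AreIsogonalAt U V W X Y ↔
      inner ℝ (U - V) (X - V) * cross (W - V) (Y - V) +
        cross (U - V) (X - V) * inner ℝ (W - V) (Y - V) = 0 := by
  have hu0 : U - V ≠ 0 := by intro h0; rw [h0] at h; simp [cross] at h
  have hw0 : W - V ≠ 0 := by intro h0; rw [h0] at h; simp [cross] at h
  have hu1 : ‖‖U - V‖⁻¹ • (U - V)‖ ^ 2 = 1 := by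
    rw [norm_smul, norm_inv, norm_norm, inv_mul_cancel₀ (norm_ne_zero_iff.2 hu0), one_pow]
  have hw1 : ‖‖W - V‖⁻¹ • (W - V)‖ ^ 2 = 1 := by
    rw [norm_smul, norm_inv, norm_norm, inv_mul_cancel₀ (norm_ne_zero_iff.2 hw0), one_pow]
  have hu2 : 0 < ‖U - V‖⁻¹ := inv_pos.2 (norm_pos_iff.2 hu0)
  have hw2 : 0 < ‖W - V‖⁻¹ := inv_pos.2 (norm_pos_iff.2 hw0)
  have hd : ‖‖U - V‖⁻¹ • (U - V) + ‖W - V‖⁻¹ • (W - V)‖ ^ 2 ≠ 0 := by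
    rw [pow_ne_zero_iff two_ne_zero, norm_ne_zero_iff]
    intro h0
    have : cross (‖U - V‖⁻¹ • (U - V) + ‖W - V‖⁻¹ • (W - V)) (‖W - V‖⁻¹ • (W - V)) =
        ‖U - V‖⁻¹ * ‖W - V‖⁻¹ * cross (U - V) (W - V) := by simp [cross]; ring
    rw [h0] at this
    have h3 : ‖U - V‖⁻¹ * ‖W - V‖⁻¹ * cross (U - V) (W - V) ≠ 0 :=
      mul_ne_zero (by positivity) h
    apply h3; rw [← this]; simp [cross]
  have hrefl : reflection (bisectorLine U V W) X =
      foot V (V + (‖U - V‖⁻¹ • (U - V) + ‖W - V‖⁻¹ • (W - V))) X - X +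
        foot V (V + (‖U - V‖⁻¹ • (U - V) + ‖W - V‖⁻¹ • (W - V))) X := by
    rw [reflection_apply']; rfl
  rw [AreIsogonalAt, collinear_iff_cross, hrefl, foot_eq, add_sub_cancel_left]
  generalize ‖U - V‖⁻¹ = a at *
  generalize ‖W - V‖⁻¹ = b at *
  have e : a * b * (inner ℝ (U - V) (X - V) * cross (W - V) (Y - V) +
        cross (U - V) (X - V) * inner ℝ (W - V) (Y - V)) =
      inner ℝ (a • (U - V)) (X - V) * cross (b • (W - V)) (Y - V) +
        cross (a • (U - V)) (X - V) * inner ℝ (b • (W - V)) (Y - V) := by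
    rw [real_inner_smul_left, real_inner_smul_left]; simp [cross]; ring
  have hab : a * b ≠ 0 := by positivity
  rw [← mul_right_inj' hab (b := _ + _), mul_zero, e]
  generalize a • (U - V) = u at *
  generalize b • (W - V) = w at *
  -- for unit vectors `u`, `w`, the square `(u + w) ^ 2` is a real multiple of `u w`, as complex
  -- numbers
  have e2 : cross (V + (inner ℝ (u + w) (X - V) / ‖u + w‖ ^ 2) • (u + w) - X +
      (V + (inner ℝ (u + w) (X - V) / ‖u + w‖ ^ 2) • (u + w)) - V) (Y - V) =
      inner ℝ u (X - V) * cross w (Y - V) + cross u (X - V) * inner ℝ w (Y - V) := by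
    refine mul_left_cancel₀ hd ?_
    have : ‖u + w‖ ^ 2 * cross (V + (inner ℝ (u + w) (X - V) / ‖u + w‖ ^ 2) • (u + w) - X +
      (V + (inner ℝ (u + w) (X - V) / ‖u + w‖ ^ 2) • (u + w)) - V) (Y - V) =
        cross ((2 * inner ℝ (u + w) (X - V)) • (u + w) - ‖u + w‖ ^ 2 • (X - V)) (Y - V) := by
      have := mul_div_cancel₀ (inner ℝ (u + w) (X - V)) hd
      set r := inner ℝ (u + w) (X - V) / ‖u + w‖ ^ 2
      rw [← this]
      simp [cross]; ring
    rw [this]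
    generalize X - V = x at *
    generalize Y - V = y at *
    rw [norm_sq_eq_coord] at hu1 hw1 ⊢
    simp only [cross, inner_eq_coord, PiLp.add_apply, PiLp.smul_apply, PiLp.sub_apply, smul_eq_mul]
    linear_combination
      -((w 0 * x 0 + w 1 * x 1) * ((u 0 + w 0) * y 1 - (u 1 + w 1) * y 0) +
        (w 0 * x 1 - w 1 * x 0) * ((u 0 + w 0) * y 0 + (u 1 + w 1) * y 1)) * hu1 -
      ((u 0 * x 0 + u 1 * x 1) * ((u 0 + w 0) * y 1 - (u 1 + w 1) * y 0) +
        (u 0 * x 1 - u 1 * x 0) * ((u 0 + w 0) * y 0 + (u 1 + w 1) * y 1)) * hw1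
  rw [e2]

/-- The line isogonal to a given line through a vertex is unique. -/
theorem cross_eq_zero_of_areIsogonalAt {U V W X Y Z : Plane} (h : cross (U - V) (W - V) ≠ 0)
    (hX : X ≠ V) (hY : AreIsogonalAt U V W X Y) (hZ : AreIsogonalAt U V W X Z) :
    cross (Y - V) (Z - V) = 0 := by
  rw [areIsogonalAt_iff h] at hY hZ
  have hu0 : U - V ≠ 0 := by intro h0; rw [h0] at h; simp [cross] at h
  have hw0 : W - V ≠ 0 := by intro h0; rw [h0] at h; simp [cross] at h
  have hx0 := sub_ne_zero.2 hX
  generalize U - V = u at *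
  generalize W - V = w at *
  generalize X - V = x at *
  generalize Y - V = y at *
  generalize Z - V = z at *
  have hpos : 0 < ‖u‖ ^ 2 * ‖x‖ ^ 2 * ‖w‖ ^ 2 := by positivity
  refine mul_left_cancel₀ hpos.ne' ?_
  -- with the complex number `k = x * conj (u w)` this is
  -- `|k| ^ 2 * Im (conj y * z) = Re (k y) * Im (k z) - Im (k y) * Re (k z)`
  have e : ‖u‖ ^ 2 * ‖x‖ ^ 2 * ‖w‖ ^ 2 * cross y z =
      (inner ℝ u x * inner ℝ w y - cross u x * cross w y) *
        (inner ℝ u x * cross w z + cross u x * inner ℝ w z) -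
      (inner ℝ u x * inner ℝ w z - cross u x * cross w z) *
        (inner ℝ u x * cross w y + cross u x * inner ℝ w y) := by
    simp only [cross, inner_eq_coord, norm_sq_eq_coord]; ring
  rw [e, hY, hZ]; ring

/-! ### The circumradius, the area and the pedal triangle -/

theorem two_mul_triCircumradius_mul_sin {A B C : Plane}
    (hABC : AffineIndependent ℝ ![A, B, C]) :
    2 * triCircumradius A B C hABC * Real.sin (∠ B A C) = dist B C := by
  have key := (mkTriangle A B C hABC).dist_div_sin_angle_eq_two_mul_circumradius
    (i₁ := 1) (i₂ := 0) (i₃ := 2) (by decide) (by decide) (by decide)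
  change dist B C / Real.sin (∠ B A C) = 2 * triCircumradius A B C hABC at key
  have hs : 0 < Real.sin (∠ B A C) :=
    (IsTriangleWithAngles.exists_dist_eq_mul_sin ⟨hABC, rfl, rfl, rfl⟩).1
  rw [← key, div_mul_cancel₀ _ hs.ne']

theorem two_mul_triCircumradius_mul_abs_cross {A B C : Plane}
    (hABC : AffineIndependent ℝ ![A, B, C]) :
    2 * triCircumradius A B C hABC * |cross (B - A) (C - A)| =
      dist B C * dist C A * dist A B := by
  rw [← sin_angle_mul_dist_mul_dist, ← two_mul_triCircumradius_mul_sin hABC]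
  ring

theorem triArea_eq (A B C : Plane) (hBC : B ≠ C) :
    triArea A B C = |cross (B - A) (C - A)| / 2 := by
  unfold triArea
  congr 1
  refine (sq_eq_sq₀ (by positivity) (by positivity)).1 ?_
  have ha : 0 < ‖C - B‖ ^ 2 := by have := sub_ne_zero.2 hBC.symm; positivity
  rw [mul_pow, sq_abs, foot_eq, dist_sq_eq_coord, dist_sq_eq_coord, inner_eq_coord]
  rw [norm_sq_eq_coord] at *
  simp [cross] at *
  field_simp
  ring

/-- A side of the pedal triangle of `M` is `AM · sin α`. -/
theorem dist_foot_foot {A B C : Plane} (hAB : A ≠ B) (hAC : A ≠ C) (M : Plane) :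
    dist (foot A C M) (foot A B M) * (dist C A * dist A B) =
      dist A M * |cross (B - A) (C - A)| := by
  have hb : 0 < ‖C - A‖ ^ 2 := by have := sub_ne_zero.2 hAC.symm; positivity
  have hc : 0 < ‖B - A‖ ^ 2 := by have := sub_ne_zero.2 hAB.symm; positivity
  refine (sq_eq_sq₀ (by positivity) (by positivity)).1 ?_
  simp only [mul_pow, sq_abs, foot_eq]
  have hr := div_mul_cancel₀ (inner ℝ (C - A) (M - A)) hb.ne'
  have hs := div_mul_cancel₀ (inner ℝ (B - A) (M - A)) hc.ne'
  generalize inner ℝ (C - A) (M - A) / ‖C - A‖ ^ 2 = r at *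
  generalize inner ℝ (B - A) (M - A) / ‖B - A‖ ^ 2 = s at *
  have e : dist (A + r • (C - A)) (A + s • (B - A)) ^ 2 * (dist C A ^ 2 * dist A B ^ 2) =
      (r * ‖C - A‖ ^ 2) ^ 2 * dist A B ^ 2 + (s * ‖B - A‖ ^ 2) ^ 2 * dist C A ^ 2 -
        2 * (r * ‖C - A‖ ^ 2) * (s * ‖B - A‖ ^ 2) * inner ℝ (B - A) (C - A) := by
    simp only [dist_sq_eq_coord, inner_eq_coord, norm_sq_eq_coord, PiLp.add_apply,
      PiLp.smul_apply, PiLp.sub_apply, smul_eq_mul]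
    ring
  rw [e, hr, hs]
  simp only [dist_sq_eq_coord, inner_eq_coord, cross, PiLp.sub_apply]
  ring

/-! ### The `√(bc)`-inversion -/

/-- The image of `D = A + y (B - A) + z (C - A)` under the inversion with centre `A` and power
`AB · AC` followed by the reflection in the bisector at `A`. As a complex number relative to the
origin `A` it is `B C / D`; the map exchanges `B` and `C`. -/
noncomputable def sqrtInversion (A B C : Plane) (y z : ℝ) : Plane :=
  A + ((z * dist C A ^ 2 / ‖y • (B - A) + z • (C - A)‖ ^ 2) • (B - A) +
    (y * dist A B ^ 2 / ‖y • (B - A) + z • (C - A)‖ ^ 2) • (C - A))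

theorem norm_sq_sqrtInversion_sub {A B C : Plane} {y z : ℝ}
    (hN : 0 < ‖y • (B - A) + z • (C - A)‖ ^ 2) :
    ‖(z * dist C A ^ 2 / ‖y • (B - A) + z • (C - A)‖ ^ 2) • (B - A) +
      (y * dist A B ^ 2 / ‖y • (B - A) + z • (C - A)‖ ^ 2) • (C - A)‖ ^ 2 =
      dist C A ^ 2 * dist A B ^ 2 / ‖y • (B - A) + z • (C - A)‖ ^ 2 := by
  have hN' := norm_sq_smul_add_smul A B C y z
  rw [norm_sq_smul_add_smul A B C (_ / _)]
  generalize ‖y • (B - A) + z • (C - A)‖ ^ 2 = N at *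
  field_simp
  rw [hN']
  ring

theorem dist_sqrtInversion {A B C : Plane} {y z : ℝ}
    (hN : 0 < ‖y • (B - A) + z • (C - A)‖ ^ 2) :
    dist A (sqrtInversion A B C y z) * ‖y • (B - A) + z • (C - A)‖ = dist C A * dist A B ∧
    dist B (sqrtInversion A B C y z) * ‖y • (B - A) + z • (C - A)‖ =
      dist A B * dist C (A + (y • (B - A) + z • (C - A))) ∧
    dist C (sqrtInversion A B C y z) * ‖y • (B - A) + z • (C - A)‖ =
      dist C A * dist B (A + (y • (B - A) + z • (C - A))) := by
  have hsq : ∀ p q : ℝ, dist B (A + (p • (B - A) + q • (C - A))) ^ 2 =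
      (1 - p) ^ 2 * dist A B ^ 2 - 2 * (1 - p) * q * inner ℝ (B - A) (C - A) +
        q ^ 2 * dist C A ^ 2 := by
    intro p q
    simp only [dist_sq_eq_coord, inner_eq_coord, PiLp.add_apply, PiLp.smul_apply,
      PiLp.sub_apply, smul_eq_mul]
    ring
  have hsq' : ∀ p q : ℝ, dist C (A + (p • (B - A) + q • (C - A))) ^ 2 =
      p ^ 2 * dist A B ^ 2 - 2 * p * (1 - q) * inner ℝ (B - A) (C - A) +
        (1 - q) ^ 2 * dist C A ^ 2 := by
    intro p q
    simp only [dist_sq_eq_coord, inner_eq_coord, PiLp.add_apply, PiLp.smul_apply,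
      PiLp.sub_apply, smul_eq_mul]
    ring
  have hA := norm_sq_sqrtInversion_sub hN
  have hN' := norm_sq_smul_add_smul A B C y z
  refine ⟨?_, ?_, ?_⟩ <;> refine (sq_eq_sq₀ (by positivity) (by positivity)).1 ?_
  · rw [mul_pow, mul_pow, sqrtInversion, dist_comm, dist_eq_norm, add_sub_cancel_left, hA,
      div_mul_cancel₀ _ hN.ne']
  · rw [mul_pow, mul_pow, sqrtInversion, hsq, hsq']
    generalize ‖y • (B - A) + z • (C - A)‖ ^ 2 = N at *
    field_simp
    rw [hN']; ring
  · rw [mul_pow, mul_pow, sqrtInversion, hsq, hsq']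
    generalize ‖y • (B - A) + z • (C - A)‖ ^ 2 = N at *
    field_simp
    rw [hN']; ring

/-- The inverse of `D` is outside the circumscribed circle exactly when `D` is on `A`'s side of the
line `B C`, which the map sends to that circle. -/
theorem lt_dist_sqrtInversion_iff {A B C : Plane} (hABC : AffineIndependent ℝ ![A, B, C])
    {y z : ℝ} (hN : 0 < ‖y • (B - A) + z • (C - A)‖ ^ 2) :
    triCircumradius A B C hABC < dist (sqrtInversion A B C y z) (triCircumcenter A B C hABC) ↔
      y + z < 1 := by
  obtain ⟨h1, h2, -⟩ := vertex_ne_of_cross ((affineIndependent_iff_cross _ _ _).1 hABC)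
  have hc : 0 < dist A B := dist_pos.2 h1
  have hb : 0 < dist C A := dist_pos.2 h2.symm
  rw [← sq_lt_sq₀ (triCircumradius_nonneg hABC) dist_nonneg, ← sub_pos, sqrtInversion,
    power_triCircumcenter, norm_sq_sqrtInversion_sub hN]
  generalize ‖y • (B - A) + z • (C - A)‖ ^ 2 = N at *
  have : dist C A ^ 2 * dist A B ^ 2 / N - z * dist C A ^ 2 / N * dist A B ^ 2 -
      y * dist A B ^ 2 / N * dist C A ^ 2 =
      dist C A ^ 2 * dist A B ^ 2 / N * (1 - (y + z)) := by field_simp; ring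
  rw [this, mul_pos_iff_of_pos_left (by positivity), sub_pos]

theorem exists_eq_sqrtInversion {A B C : Plane} (h : cross (B - A) (C - A) ≠ 0) {P : Plane}
    (hP : P ≠ A) : ∃ y z : ℝ, 0 < ‖y • (B - A) + z • (C - A)‖ ^ 2 ∧
      P = sqrtInversion A B C y z := by
  obtain ⟨h1, h2, -⟩ := vertex_ne_of_cross h
  have hc : 0 < dist A B := dist_pos.2 h1
  have hb : 0 < dist C A := dist_pos.2 h2.symm
  have hPv := eq_smul_add_smul_of_cross_ne_zero h (P - A)
  generalize cross (P - A) (C - A) / cross (B - A) (C - A) = p at hPv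
  generalize cross (B - A) (P - A) / cross (B - A) (C - A) = q at hPv
  have hM : 0 < ‖p • (B - A) + q • (C - A)‖ ^ 2 := by
    rw [← hPv]; have := sub_ne_zero.2 hP; positivity
  -- the inversion is an involution
  have hN := norm_sq_sqrtInversion_sub hM
  refine ⟨q * dist C A ^ 2 / ‖p • (B - A) + q • (C - A)‖ ^ 2,
    p * dist A B ^ 2 / ‖p • (B - A) + q • (C - A)‖ ^ 2, by rw [hN]; positivity, ?_⟩
  rw [sqrtInversion, hN, ← sub_eq_iff_eq_add', hPv]
  generalize ‖p • (B - A) + q • (C - A)‖ ^ 2 = N at *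
  congr 2 <;> field_simp

/-! ### The pedal triangle of the inverse point -/

theorem dist_pedal_sqrtInversion {A B C : Plane} (h : cross (B - A) (C - A) ≠ 0) {y z : ℝ}
    (hN : 0 < ‖y • (B - A) + z • (C - A)‖ ^ 2) {P : Plane} (hP : P = sqrtInversion A B C y z) :
    dist (foot C A P) (foot A B P) * ‖y • (B - A) + z • (C - A)‖ = |cross (B - A) (C - A)| ∧
    dist (foot A B P) (foot B C P) * ‖y • (B - A) + z • (C - A)‖ * dist B C =
      |cross (B - A) (C - A)| * dist C (A + (y • (B - A) + z • (C - A))) ∧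
    dist (foot B C P) (foot C A P) * ‖y • (B - A) + z • (C - A)‖ * dist B C =
      |cross (B - A) (C - A)| * dist B (A + (y • (B - A) + z • (C - A))) := by
  obtain ⟨h1, h2, h3⟩ := vertex_ne_of_cross h
  have hc : 0 < dist A B := dist_pos.2 h1
  have hb : 0 < dist C A := dist_pos.2 h2.symm
  obtain ⟨dA, dB, dC⟩ := dist_sqrtInversion hN
  rw [← hP] at dA dB dC
  have pA := dist_foot_foot h1 h2 P
  have pB := dist_foot_foot h3 h1.symm P
  have pC := dist_foot_foot h2.symm h3.symm P
  rw [show cross (C - B) (A - B) = cross (B - A) (C - A) by simp [cross]; ring,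
    foot_comm B A] at pB
  rw [show cross (A - C) (B - C) = cross (B - A) (C - A) by simp [cross]; ring,
    foot_comm C B] at pC
  rw [foot_comm A C] at pA
  refine ⟨?_, ?_, ?_⟩
  · refine mul_left_cancel₀ (mul_pos hb hc).ne' ?_
    linear_combination ‖y • (B - A) + z • (C - A)‖ * pA + |cross (B - A) (C - A)| * dA
  · refine mul_left_cancel₀ hc.ne' ?_
    linear_combination ‖y • (B - A) + z • (C - A)‖ * pB + |cross (B - A) (C - A)| * dB
  · refine mul_left_cancel₀ hb.ne' ?_
    linear_combination ‖y • (B - A) + z • (C - A)‖ * pC + |cross (B - A) (C - A)| * dC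

/-- The pedal triangle of the inverse of `D` is similar to the triangle `D B C`. -/
theorem hasPedalAngles_sqrtInversion_iff {A B C : Plane} (h : cross (B - A) (C - A) ≠ 0)
    {y z : ℝ} (hN : 0 < ‖y • (B - A) + z • (C - A)‖ ^ 2) {l m n α₁ β₁ γ₁ : ℝ} (hl : 0 < l)
    (hT : AreAnglesOfSides l m n α₁ β₁ γ₁) :
    HasPedalAngles A B C (sqrtInversion A B C y z) α₁ β₁ γ₁ ↔
      l * dist B (A + (y • (B - A) + z • (C - A))) = n * dist B C ∧
      l * dist C (A + (y • (B - A) + z • (C - A))) = m * dist B C := by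
  obtain ⟨d1, d2, d3⟩ := dist_pedal_sqrtInversion h hN rfl
  have hv : 0 < ‖y • (B - A) + z • (C - A)‖ := by
    by_contra hle
    rw [le_antisymm (not_lt.1 hle) (norm_nonneg _)] at hN; simp at hN
  have hδ : 0 < |cross (B - A) (C - A)| := abs_pos.2 h
  have ha : 0 < dist B C := dist_pos.2 (vertex_ne_of_cross h).2.2
  constructor
  · intro hped
    obtain ⟨s1, s2, s3, k, hk, e1, e2, e3⟩ := hped.exists_dist_eq_mul_sin
    obtain ⟨-, -, -, k', hk', f1, f2, f3⟩ := hT.exists_eq_mul_sin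
    rw [e1] at d1
    rw [e2] at d2
    rw [e3] at d3
    constructor
    · refine mul_left_cancel₀ hδ.ne' ?_
      rw [f1, f3]
      linear_combination -k' * Real.sin α₁ * d3 + k' * Real.sin γ₁ * dist B C * d1
    · refine mul_left_cancel₀ hδ.ne' ?_
      rw [f1, f2]
      linear_combination -k' * Real.sin α₁ * d2 + k' * Real.sin β₁ * dist B C * d1
  · rintro ⟨hB, hC⟩
    refine .of_dist_eq_mul hT
      (k := |cross (B - A) (C - A)| / (‖y • (B - A) + z • (C - A)‖ * l)) (by positivity) ?_ ?_ ?_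
    · rw [← d1]; field_simp
    · refine mul_right_cancel₀ (mul_pos hv ha).ne' ?_
      rw [← mul_assoc, d2]
      field_simp
      linear_combination hC
    · refine mul_right_cancel₀ (mul_pos hv ha).ne' ?_
      rw [← mul_assoc, d3]
      field_simp
      linear_combination hB

/-! ### Isogonal conjugates of type II -/

theorem mem_sigma12_of_coord {A B C : Plane} (hABC : AffineIndependent ℝ ![A, B, C]) {p q : ℝ}
    (hp : 0 < p) (hq : 0 < q) (hpq : 1 < p + q)
    (hpow : p * dist A B ^ 2 + q * dist C A ^ 2 < ‖p • (B - A) + q • (C - A)‖ ^ 2) :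
    A + (p • (B - A) + q • (C - A)) ∈ sigma12 A B C hABC := by
  have h := (affineIndependent_iff_cross _ _ _).1 hABC
  obtain ⟨h1, h2, h3⟩ := vertex_ne_of_cross h
  have hδ : 0 < cross (B - A) (C - A) ^ 2 := by positivity
  refine ⟨sSameSide_line_of_cross h1 ?_, sSameSide_line_of_cross h2 ?_,
    sOppSide_line_of_cross h3 ?_, ?_⟩
  · have : cross (B - A) (C - A) * cross (B - A) (A + (p • (B - A) + q • (C - A)) - A) =
        q * cross (B - A) (C - A) ^ 2 := by simp [cross]; ring
    rw [this]; positivity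
  · have : cross (C - A) (B - A) * cross (C - A) (A + (p • (B - A) + q • (C - A)) - A) =
        p * cross (B - A) (C - A) ^ 2 := by simp [cross]; ring
    rw [this]; positivity
  · have : cross (C - B) (A - B) * cross (C - B) (A + (p • (B - A) + q • (C - A)) - B) =
        -((p + q - 1) * cross (B - A) (C - A) ^ 2) := by simp [cross]; ring
    rw [this, neg_lt_zero]
    exact mul_pos (by linarith) hδ
  · rw [← sq_lt_sq₀ (triCircumradius_nonneg hABC) dist_nonneg, ← sub_pos, power_triCircumcenter]
    linarith

theorem cross_smul_add_smul (u v : Plane) (a b c d : ℝ) :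
    cross (a • u + b • v) (c • u + d • v) = (a * d - b * c) * cross u v := by
  simp [cross]; ring

theorem inner_smul_add_smul (u v : Plane) (a b c d : ℝ) :
    inner ℝ (a • u + b • v) (c • u + d • v) =
      a * c * ‖u‖ ^ 2 + (a * d + b * c) * inner ℝ u v + b * d * ‖v‖ ^ 2 := by
  simp only [inner_eq_coord, norm_sq_eq_coord, PiLp.add_apply, PiLp.smul_apply, smul_eq_mul]
  ring

/-- The second intersection of the line `A D` with the circle `B C D` is isogonally conjugate to the
inverse of `D`. -/
theorem areIsogonallyConjugate_sqrtInversion {A B C : Plane} (h : cross (B - A) (C - A) ≠ 0)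
    {y z : ℝ} (hyz : y + z < 1) (hN : 0 < ‖y • (B - A) + z • (C - A)‖ ^ 2) :
    AreIsogonallyConjugate A B C (sqrtInversion A B C y z)
      (A + rayParam A B C y z • (y • (B - A) + z • (C - A))) := by
  have hB : cross (C - B) (A - B) ≠ 0 := by
    rwa [show cross (C - B) (A - B) = cross (B - A) (C - A) by simp [cross]; ring]
  have hC : cross (A - C) (B - C) ≠ 0 := by
    rwa [show cross (A - C) (B - C) = cross (B - A) (C - A) by simp [cross]; ring]
  have hs : 0 < 1 - (y + z) := by linarith
  have hN' := norm_sq_smul_add_smul A B C y z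
  -- all vectors are expressed in the basis `B - A`, `C - A`
  have eB : C - B = (-1 : ℝ) • (B - A) + (1 : ℝ) • (C - A) := by module
  have eB' : A - B = (-1 : ℝ) • (B - A) + (0 : ℝ) • (C - A) := by module
  have eC : B - C = (1 : ℝ) • (B - A) + (-1 : ℝ) • (C - A) := by module
  have eC' : A - C = (0 : ℝ) • (B - A) + (-1 : ℝ) • (C - A) := by module
  have eX : ∀ p q : ℝ, A + (p • (B - A) + q • (C - A)) - A = p • (B - A) + q • (C - A) ∧
      A + (p • (B - A) + q • (C - A)) - B = (p - 1) • (B - A) + q • (C - A) ∧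
      A + (p • (B - A) + q • (C - A)) - C = p • (B - A) + (q - 1) • (C - A) := by
    intro p q; refine ⟨?_, ?_, ?_⟩ <;> module
  have eQ : A + rayParam A B C y z • (y • (B - A) + z • (C - A)) =
      A + ((rayParam A B C y z * y) • (B - A) + (rayParam A B C y z * z) • (C - A)) := by
    module
  have hAB : ‖B - A‖ = dist A B := by rw [dist_comm, dist_eq_norm]
  have hCA : ‖C - A‖ = dist C A := by rw [dist_eq_norm]
  have hr : rayParam A B C y z = (y * dist A B ^ 2 + z * dist C A ^ 2 -
    ‖y • (B - A) + z • (C - A)‖ ^ 2) / ((1 - (y + z)) * ‖y • (B - A) + z • (C - A)‖ ^ 2) := rfl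
  rw [eQ, sqrtInversion]
  refine ⟨(areIsogonalAt_iff h).2 ?_, (areIsogonalAt_iff hB).2 ?_,
    (areIsogonalAt_iff hC).2 ?_⟩
  · rw [(eX _ _).1, (eX _ _).1]
    have i1 := fun p q => inner_smul_add_smul (B - A) (C - A) 1 0 p q
    have i2 := fun p q => inner_smul_add_smul (B - A) (C - A) 0 1 p q
    have c1 := fun p q => cross_smul_add_smul (B - A) (C - A) 1 0 p q
    have c2 := fun p q => cross_smul_add_smul (B - A) (C - A) 0 1 p q
    simp only [one_smul, zero_smul, add_zero, zero_add] at i1 i2 c1 c2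
    rw [i1, i2, c1, c2, hAB, hCA]
    ring
  · rw [(eX _ _).2.1, (eX _ _).2.1, eB, eB']
    generalize ‖y • (B - A) + z • (C - A)‖ ^ 2 = N at *
    rw [inner_smul_add_smul, inner_smul_add_smul, cross_smul_add_smul, cross_smul_add_smul, hr,
      hAB, hCA]
    field_simp
    rw [hN']; ring
  · rw [(eX _ _).2.2, (eX _ _).2.2, eC, eC']
    generalize ‖y • (B - A) + z • (C - A)‖ ^ 2 = N at *
    rw [inner_smul_add_smul, inner_smul_add_smul, cross_smul_add_smul, cross_smul_add_smul, hr,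
      hAB, hCA]
    field_simp
    rw [hN']; ring

/-! ### The exterior point with prescribed pedal angles -/

/-- The point at which two lines through distinct vertices meet is determined by these lines. -/
theorem eq_of_cross_eq_zero {A B Q Y : Plane} (h : cross (Q - A) (B - A) ≠ 0)
    (hA : cross (Q - A) (Y - A) = 0) (hB : cross (Q - B) (Y - B) = 0) : Y = Q := by
  have hq : Q - A ≠ 0 := by intro h0; rw [h0] at h; simp [cross] at h
  obtain ⟨r, hr⟩ := exists_smul_of_cross_eq_zero hq hA
  have e : cross (Q - B) (Y - B) = (r - 1) * cross (Q - A) (B - A) := by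
    rw [show Q - B = (Q - A) - (B - A) by abel, show Y - B = (Y - A) - (B - A) by abel, hr]
    simp [cross]; ring
  rw [e, mul_eq_zero, or_iff_left h, sub_eq_zero] at hB
  rw [hB, one_smul] at hr
  exact sub_left_injective hr

/-- For `D` inside the triangle, the second intersection `Q` of `A D` with the circle `B C D` is
the only point of type II isogonally conjugate to the inverse of `D`. Uniqueness needs only the
conditions at `A` and `B`, which fix two lines through `Q`. -/
theorem areIsogonalTypeII_sqrtInversion_iff {A B C : Plane}
    (hABC : AffineIndependent ℝ ![A, B, C]) {y z : ℝ} (hy : 0 < y) (hz : 0 < z)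
    (hyz : y + z < 1) (Y : Plane) :
    AreIsogonalTypeII A B C hABC (sqrtInversion A B C y z) Y ↔
      Y = A + rayParam A B C y z • (y • (B - A) + z • (C - A)) := by
  have h := (affineIndependent_iff_cross _ _ _).1 hABC
  obtain ⟨h1, h2, h3⟩ := vertex_ne_of_cross h
  have hc : 0 < dist A B := dist_pos.2 h1
  have hb : 0 < dist C A := dist_pos.2 h2.symm
  have hN := norm_sq_pos_of_pos h (z := z) hy
  have hlt := norm_sq_lt_of_pos h hy hz
  have hr := one_lt_rayParam h hy hz hyz
  have hr2 := one_lt_rayParam_mul h hy hz hyz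
  have hs : 0 < 1 - (y + z) := by linarith
  have hconj := areIsogonallyConjugate_sqrtInversion h hyz hN
  have hext := (lt_dist_sqrtInversion_iff hABC hN).2 hyz
  obtain ⟨oA, oB, oC⟩ := dist_triCircumcenter hABC
  constructor
  · rintro ⟨⟨iA, iB, -⟩, -⟩
    have hPA : sqrtInversion A B C y z ≠ A := by
      intro h0; rw [h0, oA] at hext; exact lt_irrefl _ hext
    have hPB : sqrtInversion A B C y z ≠ B := by
      intro h0; rw [h0, oB] at hext; exact lt_irrefl _ hext
    have hB : cross (C - B) (A - B) ≠ 0 := by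
      rwa [show cross (C - B) (A - B) = cross (B - A) (C - A) by simp [cross]; ring]
    have cA := cross_eq_zero_of_areIsogonalAt h hPA hconj.1 iA
    have cB := cross_eq_zero_of_areIsogonalAt hB hPB hconj.2.1 iB
    refine eq_of_cross_eq_zero ?_ cA cB
    have : cross (A + rayParam A B C y z • (y • (B - A) + z • (C - A)) - A) (B - A) =
        -(rayParam A B C y z * z * cross (B - A) (C - A)) := by simp [cross]; ring
    rw [this, neg_ne_zero]
    exact mul_ne_zero (by positivity) h
  · rintro rfl
    refine ⟨hconj, Or.inl ⟨?_, ?_⟩⟩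
    · refine mem_sigma12_of_coord hABC (by positivity) (by positivity) ?_ ?_
      · rw [← add_div, one_lt_div hN]
        nlinarith
      · rw [norm_sq_sqrtInversion_sub hN]
        generalize ‖y • (B - A) + z • (C - A)‖ ^ 2 = N at *
        have : dist C A ^ 2 * dist A B ^ 2 / N - (z * dist C A ^ 2 / N * dist A B ^ 2 +
            y * dist A B ^ 2 / N * dist C A ^ 2) =
            dist C A ^ 2 * dist A B ^ 2 / N * (1 - (y + z)) := by field_simp; ring
        rw [← sub_pos, this]
        positivity
    · have e : A + rayParam A B C y z • (y • (B - A) + z • (C - A)) =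
          A + ((rayParam A B C y z * y) • (B - A) + (rayParam A B C y z * z) • (C - A)) := by
        module
      rw [e]
      refine mem_sigma12_of_coord hABC (by positivity) (by positivity) (by linarith) ?_
      have e2 : ‖(rayParam A B C y z * y) • (B - A) + (rayParam A B C y z * z) • (C - A)‖ ^ 2 =
          rayParam A B C y z ^ 2 * ‖y • (B - A) + z • (C - A)‖ ^ 2 := by
        rw [norm_sq_smul_add_smul, norm_sq_smul_add_smul]; ring
      have e3 : rayParam A B C y z * ((1 - (y + z)) * ‖y • (B - A) + z • (C - A)‖ ^ 2) =
          y * dist A B ^ 2 + z * dist C A ^ 2 - ‖y • (B - A) + z • (C - A)‖ ^ 2 :=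
        div_mul_cancel₀ _ (mul_pos hs hN).ne'
      rw [e2]
      generalize rayParam A B C y z = t at *
      generalize ‖y • (B - A) + z • (C - A)‖ ^ 2 = N at *
      have e4 : (1 - (y + z)) * (t * N - (y * dist A B ^ 2 + z * dist C A ^ 2)) =
          (y + z) * (y * dist A B ^ 2 + z * dist C A ^ 2) - N := by linear_combination e3
      have e5 : 0 < t * N - (y * dist A B ^ 2 + z * dist C A ^ 2) := by
        refine pos_of_mul_pos_right (a := 1 - (y + z)) ?_ hs.le
        rw [e4]; linarith
      have e6 := mul_pos (zero_lt_one.trans hr) e5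
      linarith

/-- Existence and uniqueness of the exterior point with prescribed pedal angles: the inversion
reduces it to the existence and uniqueness of the apex `D`. -/
theorem existsUnique_hasPedalAngles {A B C : Plane} (hABC : AffineIndependent ℝ ![A, B, C])
    {l m n α₁ β₁ γ₁ : ℝ} (hl : 0 < l) (hm : 0 < m) (hn : 0 < n) (h1 : l < m + n)
    (h2 : m < n + l) (h3 : n < l + m) (hT : AreAnglesOfSides l m n α₁ β₁ γ₁)
    (hβ : β₁ < ∠ A B C) :
    ∃! P : Plane, triCircumradius A B C hABC < dist P (triCircumcenter A B C hABC) ∧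
      HasPedalAngles A B C P α₁ β₁ γ₁ := by
  have h := (affineIndependent_iff_cross _ _ _).1 hABC
  obtain ⟨h12, h13, h23⟩ := vertex_ne_of_cross h
  refine existsUnique_of_exists_of_unique ?_ ?_
  · obtain ⟨D, hB, hC, hside⟩ := exists_apex h hl hm hn h1 h2 h3
    have hDv := eq_smul_add_smul_of_cross_ne_zero h (D - A)
    generalize cross (D - A) (C - A) / cross (B - A) (C - A) = y at hDv
    generalize cross (B - A) (D - A) / cross (B - A) (C - A) = z at hDv
    obtain rfl : D = A + (y • (B - A) + z • (C - A)) := by rw [← hDv]; abel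
    have hyz : y + z < 1 := by
      have e := cross_sub_ray A B C y z 1
      rw [one_smul, one_mul] at e
      rw [e, show cross (B - A) (C - A) * ((1 - (y + z)) * cross (B - A) (C - A)) =
        (1 - (y + z)) * cross (B - A) (C - A) ^ 2 by ring] at hside
      linarith [pos_of_mul_pos_left hside (sq_nonneg _)]
    have hang := (isTriangleWithAngles_apex hl h23 hT hB hC).2.2.1
    rw [← hang, angle_lt_angle_iff_pos h hyz] at hβ
    have hN : 0 < ‖y • (B - A) + z • (C - A)‖ ^ 2 := by
      rw [add_comm]; exact norm_sq_pos_of_pos (cross_swap_ne_zero h) hβ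
    exact ⟨sqrtInversion A B C y z, (lt_dist_sqrtInversion_iff hABC hN).2 hyz,
      (hasPedalAngles_sqrtInversion_iff h hN hl hT).2 ⟨hB, hC⟩⟩
  · have hne : ∀ {P : Plane}, triCircumradius A B C hABC < dist P (triCircumcenter A B C hABC) →
        P ≠ A := by
      rintro P hP rfl
      rw [(dist_triCircumcenter hABC).1] at hP
      exact lt_irrefl _ hP
    rintro P P' ⟨hP, hPp⟩ ⟨hP', hPp'⟩
    obtain ⟨y, z, hN, rfl⟩ := exists_eq_sqrtInversion h (hne hP)
    obtain ⟨y', z', hN', rfl⟩ := exists_eq_sqrtInversion h (hne hP')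
    rw [lt_dist_sqrtInversion_iff hABC hN] at hP
    rw [lt_dist_sqrtInversion_iff hABC hN'] at hP'
    obtain ⟨hB, hC⟩ := (hasPedalAngles_sqrtInversion_iff h hN hl hT).1 hPp
    obtain ⟨hB', hC'⟩ := (hasPedalAngles_sqrtInversion_iff h hN' hl hT).1 hPp'
    have hD := apex_unique h23 (mul_left_cancel₀ hl.ne' (hB.trans hB'.symm))
      (mul_left_cancel₀ hl.ne' (hC.trans hC'.symm)) (by
        have e := cross_sub_ray A B C y z 1
        have e' := cross_sub_ray A B C y' z' 1
        rw [one_smul, one_mul] at e e'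
        rw [e, e', show (1 - (y + z)) * cross (B - A) (C - A) *
          ((1 - (y' + z')) * cross (B - A) (C - A)) =
          (1 - (y + z)) * (1 - (y' + z')) * cross (B - A) (C - A) ^ 2 by ring]
        have := sub_pos.2 hP
        have := sub_pos.2 hP'
        positivity)
    have hD' := add_left_cancel hD
    have hz : z = z' := by
      have := congrArg (fun v => cross (B - A) v) hD'
      have e : ∀ y z : ℝ, cross (B - A) (y • (B - A) + z • (C - A)) =
          z * cross (B - A) (C - A) := by intro y z; simp [cross]; ring
      simp only [e] at this
      exact mul_right_cancel₀ h this
    have hy : y = y' := by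
      have := congrArg (fun v => cross v (C - A)) hD'
      have e : ∀ y z : ℝ, cross (y • (B - A) + z • (C - A)) (C - A) =
          y * cross (B - A) (C - A) := by intro y z; simp [cross]; ring
      simp only [e] at this
      exact mul_right_cancel₀ h this
    rw [hy, hz]

theorem mixedFermat_eq_mul {l m n α₁ β₁ γ₁ : ℝ} (hT : AreAnglesOfSides l m n α₁ β₁ γ₁)
    (A B C : Plane) :
    0 < l / Real.sin α₁ ∧ ∀ Y : Plane, mixedFermat A B C l m n Y = l / Real.sin α₁ *
      mixedFermat A B C (Real.sin α₁) (Real.sin β₁) (Real.sin γ₁) Y := by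
  obtain ⟨s1, s2, s3, k, hk, rfl, rfl, rfl⟩ := hT.exists_eq_mul_sin
  rw [mul_div_cancel_right₀ _ s1.ne']
  refine ⟨hk, fun Y => ?_⟩
  unfold mixedFermat
  ring

/-- The point `Q` isogonally conjugate to the exterior point `P` with the prescribed pedal angles is
the unique minimizer. -/
theorem minimizers_eq_singleton_of_hasPedalAngles {A B C : Plane}
    (hABC : AffineIndependent ℝ ![A, B, C]) {l m n α₁ β₁ γ₁ : ℝ} (hl : 0 < l)
    (hT : AreAnglesOfSides l m n α₁ β₁ γ₁) (hβ : β₁ < ∠ A B C) (hγ : γ₁ < ∠ A C B) {P : Plane}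
    (hP : triCircumradius A B C hABC < dist P (triCircumcenter A B C hABC))
    (hped : HasPedalAngles A B C P α₁ β₁ γ₁) :
    ∃ Q : Plane, (∀ Y : Plane, AreIsogonalTypeII A B C hABC P Y ↔ Y = Q) ∧
      minimizers (mixedFermat A B C l m n) = {Q} ∧
      ∃ hP : AffineIndependent ℝ ![foot B C P, foot C A P, foot A B P],
        mixedFermat A B C (Real.sin α₁) (Real.sin β₁) (Real.sin γ₁) Q =
          -(dist B C * dist C A * dist A B /
            (4 * triCircumradius A B C hABC *
              triCircumradius (foot B C P) (foot C A P) (foot A B P) hP)) ∧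
        mixedFermat A B C (Real.sin α₁) (Real.sin β₁) (Real.sin γ₁) Q =
          -(triArea A B C /
            triCircumradius (foot B C P) (foot C A P) (foot A B P) hP) := by
  have h := (affineIndependent_iff_cross _ _ _).1 hABC
  obtain ⟨h12, h13, h23⟩ := vertex_ne_of_cross h
  have hPA : P ≠ A := by
    rintro rfl
    rw [(dist_triCircumcenter hABC).1] at hP
    exact lt_irrefl _ hP
  obtain ⟨y, z, hN, rfl⟩ := exists_eq_sqrtInversion h hPA
  have hyz := (lt_dist_sqrtInversion_iff hABC hN).1 hP
  obtain ⟨hB, hC⟩ := (hasPedalAngles_sqrtInversion_iff h hN hl hT).1 hped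
  obtain ⟨hi, hα, -, -⟩ := hped
  obtain ⟨-, -, aB, aC⟩ := isTriangleWithAngles_apex hl h23 hT hB hC
  rw [← aB, angle_lt_angle_iff_pos h hyz] at hβ
  rw [← aC, angle_lt_angle_iff_pos' h hyz] at hγ
  obtain ⟨hmin, hval⟩ := minimizers_eq_singleton_ray h hl hγ hβ hyz hB hC
  refine ⟨_, areIsogonalTypeII_sqrtInversion_iff hABC hγ hβ hyz, hmin, hi, ?_⟩
  obtain ⟨hk, hscale⟩ := mixedFermat_eq_mul hT A B C
  have hs : 0 < Real.sin α₁ := hT.exists_eq_mul_sin.1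
  have hg : mixedFermat A B C (Real.sin α₁) (Real.sin β₁) (Real.sin γ₁)
      (A + rayParam A B C y z • (y • (B - A) + z • (C - A))) =
      -(Real.sin α₁ * ‖y • (B - A) + z • (C - A)‖) := by
    refine mul_left_cancel₀ hk.ne' ?_
    rw [← hscale, hval]; field_simp
  have r := two_mul_triCircumradius_mul_abs_cross hABC
  have r1 := two_mul_triCircumradius_mul_sin hi
  rw [hα] at r1
  have d := (dist_pedal_sqrtInversion h hN rfl).1
  rw [← r1] at d
  have hδ : 0 < |cross (B - A) (C - A)| := abs_pos.2 h
  have hR : triCircumradius A B C hABC ≠ 0 := by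
    intro h0; rw [h0] at r
    have := mul_pos (mul_pos (dist_pos.2 h23) (dist_pos.2 h13.symm)) (dist_pos.2 h12)
    linarith
  have hR1 : triCircumradius (foot B C (sqrtInversion A B C y z))
      (foot C A (sqrtInversion A B C y z)) (foot A B (sqrtInversion A B C y z)) hi ≠ 0 := by
    intro h0; rw [h0] at d; linarith
  rw [hg, triArea_eq A B C h23, ← r, ← d]
  constructor <;> field_simp
  ring

/-! ### The comparison of the cases -/

theorem IsTriangleWithAngles.add_add_eq_pi {X Y Z : Plane} {α β γ : ℝ}
    (h : IsTriangleWithAngles X Y Z α β γ) : α + β + γ = Real.pi := by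
  obtain ⟨hi, rfl, rfl, rfl⟩ := h
  obtain ⟨h1, -, -⟩ := vertex_ne_of_cross ((affineIndependent_iff_cross _ _ _).1 hi)
  have := EuclideanGeometry.angle_add_angle_add_angle_eq_pi Z h1.symm
  rw [angle_comm Y Z X, angle_comm Z X Y] at this
  linarith

theorem sides_proportional_of_angle_eq {A B C : Plane} (hABC : AffineIndependent ℝ ![A, B, C])
    {l m n α₁ β₁ γ₁ : ℝ} (hT : AreAnglesOfSides l m n α₁ β₁ γ₁) (hβ : β₁ = ∠ A B C)
    (hγ : γ₁ = ∠ A C B) : l * dist B A = n * dist B C ∧ l * dist C A = m * dist B C := by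
  have hABC' : IsTriangleWithAngles A B C _ _ _ := ⟨hABC, rfl, rfl, rfl⟩
  have hα : α₁ = ∠ B A C := by
    obtain ⟨X, Y, Z, -, -, -, hXYZ⟩ := hT
    have := hXYZ.add_add_eq_pi
    have := hABC'.add_add_eq_pi
    linarith
  obtain ⟨-, -, -, K, -, e1, e2, e3⟩ := hABC'.exists_dist_eq_mul_sin
  obtain ⟨-, -, -, k, -, rfl, rfl, rfl⟩ := hT.exists_eq_mul_sin
  rw [dist_comm B A, e1, e2, e3, hα, hβ, hγ]
  constructor <;> ring

theorem mixedFermat_left_lt_right_iff {A B C : Plane} (hBC : B ≠ C) {l m n : ℝ} (hl : 0 < l) :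
    (mixedFermat A B C l m n B < mixedFermat A B C l m n C ↔
        (dist C A - dist A B) / dist B C < (m - n) / l) ∧
      (mixedFermat A B C l m n C < mixedFermat A B C l m n B ↔
        (m - n) / l < (dist C A - dist A B) / dist B C) := by
  have ha : 0 < dist B C := dist_pos.2 hBC
  rw [div_lt_div_iff₀ ha hl, div_lt_div_iff₀ hl ha]
  simp only [mixedFermat, dist_self, dist_comm C B, dist_comm A C]
  constructor <;> constructor <;> intro h <;> linarith

theorem mainTheorem5 (A B C : Plane) (hABC : AffineIndependent ℝ ![A, B, C])
    (l m n : ℝ) (hl : 0 < l) (hm : 0 < m) (hn : 0 < n) :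
    -- weights which are not the sides of a nondegenerate triangle
    (m + n ≤ l → minimizers (mixedFermat A B C l m n) = ∅) ∧
    (n + l ≤ m → minimizers (mixedFermat A B C l m n) = {B}) ∧
    (l + m ≤ n → minimizers (mixedFermat A B C l m n) = {C}) ∧
    -- weights which are the sides of a triangle, with angles `α₁`, `β₁`, `γ₁`
    (l < m + n → m < n + l → n < l + m →
      (∃ α₁ β₁ γ₁ : ℝ, AreAnglesOfSides l m n α₁ β₁ γ₁) ∧
      ∀ α₁ β₁ γ₁ : ℝ, AreAnglesOfSides l m n α₁ β₁ γ₁ →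
        -- passing to the proportional weights `sin α₁`, `sin β₁`, `sin γ₁`
        (0 < l / Real.sin α₁ ∧ ∀ Y : Plane, mixedFermat A B C l m n Y =
          l / Real.sin α₁ *
            mixedFermat A B C (Real.sin α₁) (Real.sin β₁) (Real.sin γ₁) Y) ∧
        -- case 1
        (β₁ = ∠ A B C → γ₁ = ∠ A C B →
          minimizers (mixedFermat A B C l m n) = arcBC A B C hABC ∧
          ∀ Y ∈ arcBC A B C hABC,
            mixedFermat A B C (Real.sin α₁) (Real.sin β₁) (Real.sin γ₁) Y = 0) ∧
        -- case 2
        (β₁ < ∠ A B C → γ₁ < ∠ A C B →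
          (∃! P : Plane, triCircumradius A B C hABC < dist P (triCircumcenter A B C hABC) ∧
            HasPedalAngles A B C P α₁ β₁ γ₁) ∧
          ∀ P : Plane, triCircumradius A B C hABC < dist P (triCircumcenter A B C hABC) →
            HasPedalAngles A B C P α₁ β₁ γ₁ →
            ∃ Q : Plane, (∀ Y : Plane, AreIsogonalTypeII A B C hABC P Y ↔ Y = Q) ∧
              minimizers (mixedFermat A B C l m n) = {Q} ∧
              ∃ hP : AffineIndependent ℝ ![foot B C P, foot C A P, foot A B P],
                mixedFermat A B C (Real.sin α₁) (Real.sin β₁) (Real.sin γ₁) Q =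
                  -(dist B C * dist C A * dist A B /
                    (4 * triCircumradius A B C hABC *
                      triCircumradius (foot B C P) (foot C A P) (foot A B P) hP)) ∧
                mixedFermat A B C (Real.sin α₁) (Real.sin β₁) (Real.sin γ₁) Q =
                  -(triArea A B C /
                    triCircumradius (foot B C P) (foot C A P) (foot A B P) hP)) ∧
        -- case 3: all other angles
        (¬ (β₁ = ∠ A B C ∧ γ₁ = ∠ A C B) → ¬ (β₁ < ∠ A B C ∧ γ₁ < ∠ A C B) →
          ((Real.sin (∠ A B C) - Real.sin (∠ A C B)) / Real.sin (∠ B A C) <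
              (Real.sin β₁ - Real.sin γ₁) / Real.sin α₁ →
            minimizers (mixedFermat A B C l m n) = {B}) ∧
          ((Real.sin β₁ - Real.sin γ₁) / Real.sin α₁ =
              (Real.sin (∠ A B C) - Real.sin (∠ A C B)) / Real.sin (∠ B A C) →
            minimizers (mixedFermat A B C l m n) = {B, C}) ∧
          ((Real.sin β₁ - Real.sin γ₁) / Real.sin α₁ <
              (Real.sin (∠ A B C) - Real.sin (∠ A C B)) / Real.sin (∠ B A C) →
            minimizers (mixedFermat A B C l m n) = {C}))) := by
  have h := (affineIndependent_iff_cross _ _ _).1 hABC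
  have hswap : mixedFermat A B C l m n = mixedFermat A C B l n m :=
    funext (mixedFermat_swap A B C l m n)
  refine ⟨minimizers_eq_empty h hm hn, minimizers_eq_singleton_of_add_le h hl hn, ?_, ?_⟩
  · intro hle
    rw [hswap]
    exact minimizers_eq_singleton_of_add_le (cross_swap_ne_zero h) hl hm (by linarith)
  intro h1 h2 h3
  refine ⟨exists_areAnglesOfSides hl hm hn h1 h2 h3, fun α₁ β₁ γ₁ hT => ?_⟩
  obtain ⟨hk, hscale⟩ := mixedFermat_eq_mul hT A B C
  refine ⟨⟨hk, hscale⟩, ?_, ?_, ?_⟩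
  · intro hβ hγ
    obtain ⟨hB, hC⟩ := sides_proportional_of_angle_eq hABC hT hβ hγ
    obtain ⟨harc, hzero⟩ := minimizers_eq_arcBC hABC hl hB hC
    refine ⟨harc, fun Y hY => ?_⟩
    have := hzero Y hY
    rwa [hscale, mul_eq_zero, or_iff_right hk.ne'] at this
  · intro hβ hγ
    exact ⟨existsUnique_hasPedalAngles hABC hl hm hn h1 h2 h3 hT hβ, fun P hP hped =>
      minimizers_eq_singleton_of_hasPedalAngles hABC hl hT hβ hγ hP hped⟩
  · intro hne hnlt
    have hsub := minimizers_subset_pair h hl hm hn h1 h3 hT hne hnlt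
    have hnon := nonempty_minimizers (A := A) (B := B) (C := C) hm.le hn.le h1
    obtain ⟨c1, c2⟩ := mixedFermat_left_lt_right_iff (A := A) (m := m) (n := n)
      (vertex_ne_of_cross h).2.2 hl
    -- by the law of sines the two sides of the criterion are `(b - c) / a` and `(m - n) / l`
    have q : (dist C A - dist A B) / dist B C =
        (Real.sin (∠ A B C) - Real.sin (∠ A C B)) / Real.sin (∠ B A C) := by
      obtain ⟨s, -, -, K, hK, e1, e2, e3⟩ :=
        IsTriangleWithAngles.exists_dist_eq_mul_sin ⟨hABC, rfl, rfl, rfl⟩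
      rw [e1, e2, e3, ← mul_sub, mul_div_mul_left _ _ hK.ne']
    have q1 : (m - n) / l = (Real.sin β₁ - Real.sin γ₁) / Real.sin α₁ := by
      obtain ⟨s, -, -, k, hk, e1, e2, e3⟩ := hT.exists_eq_mul_sin
      rw [e1, e2, e3, ← mul_sub, mul_div_mul_left _ _ hk.ne']
    rw [q, q1] at c1 c2
    refine ⟨fun hlt => ?_, fun heq => ?_, fun hlt => ?_⟩
    · exact minimizers_eq_left_of_subset_pair hnon hsub (c1.2 hlt)
    · refine minimizers_eq_pair_of_subset_pair hnon hsub (le_antisymm ?_ ?_)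
      · exact not_lt.1 fun hlt => (c2.1 hlt).ne heq
      · exact not_lt.1 fun hlt => (c1.1 hlt).ne heq.symm
    · rw [Set.pair_comm] at hsub
      exact minimizers_eq_left_of_subset_pair hnon hsub (c2.2 hlt)
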